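/- **Setting.** Let $d\ge 1$ and equip $\mathbb Z^d$ with $|n|=\max_i|n_i|$; put $\langle k\rangle=\max\{1,|k|\}$. Let $r>d$, let $\mathcal T(m,n)=|m-n|^{-r}$ for $m\ne n$ and $\mathcal T(n,n)=0$, and let $\|\mathcal T\|$ be its operator norm on $\ell^2(\mathbb Z^d)$. Let $\{V_\omega(n)\}_{n\in\mathbb Z^d}$ be i.i.d. real random variables on a probability space $(\Omega,\mathcal F,\mathbb P)$ with common law $\mu$, where $\mathrm{supp}(\mu)$ contains at least two points and $\mathrm{supp}(\mu)\subset[-M,M]$, $M>0$. For $\lambda\ge 1$ let $H_\omega=\lambda^{-1}\mathcal T+V_\omega(n)\delta_{nn'}$. For finite $\Lambda\subset\mathbb Z^d$ let $H_\Lambda=R_\Lambda H_\omega R_\Lambda$ ($R_\Lambda$ the restriction to $\Lambda$) and $G_\Lambda(E)=(H_\Lambda-E)^{-1}$ when this inverse exists. For $L\in\mathbb N$ let $\Lambda_L(n)=\{k\in\mathbb Z^d:|k-n|\le L\}$. **Sobolev norms.** Fix $s_0>d/2$ and a constant $C_0=C_0(s_0)>0$ such that, with $\|u\|_s^2=C_0\sum_k|u(k)|^2\langle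 k\rangle^{2s}$ and $(u_1u_2)(k)=\sum_{k'}u_1(k-k')u_2(k')$, for every $s\ge s_0$ there is $C(s)>0$, with $C(s_0)=\tfrac12$, such that $$\|u_1u_2\|_s\le \tfrac12\|u_1\|_{s_0}\|u_2\|_s+C(s)\|u_1\|_s\|u_2\|_{s_0}$$ for all $u_1,u_2\in\mathbb C^{\mathbb Z^d}$ with $\|u_1\|_s,\|u_2\|_s<\infty$. For a complex matrix $\mathcal M$ with rows in $X_1\subset\mathbb Z^d$ and columns in $X_2\subset\mathbb Z^d$ let $$\|\mathcal M\|_s^2=C_0\sum_{k\in X_1-X_2}\Big(\sup_{k_1-k_2=k}|\mathcal M(k_1,k_2)|\Big)^2\langle k\rangle^{2s}.$$ **Good and bad cubes.** Given $\tau'$ and $r_1$ with $s_0\le r_1<r-d/2$, and $\delta\in(0,1)$, the cube $\Lambda_L(n)$ is $(E,\delta)$-good if $G_{\Lambda_L(n)}(E)$ exists and $\|G_{\Lambda_L(n)}(E)\|_s\le L^{\tau'+\delta s}$ for all $s\in[s_0,r_1]$; otherwise it is $(E,\delta)$-bad. **Parameters.** Let $\alpha,\tau,\tau',r_1>1$,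 $\xi>0$, $\delta\in(0,1)$ satisfy $$\begin{aligned}&-(1-\delta)r_1+\tau'+2s_0<0,\\&-\xi r_1+\tau'+\alpha\tau+(3+\delta+4\xi)s_0<0,\\&\alpha^{-1}\big(2\tau'+2\alpha\tau+(5+4\xi+2\delta)s_0\big)+s_0<\tau',\end{aligned}$$ and $1+\xi<\alpha$. Let $p>\alpha d$, let $J\in 2\mathbb N$, and let $I\subset\mathbb R$ be an interval with $|I|\le 1$ and $I\cap[-\|\mathcal T\|-M,\|\mathcal T\|+M]\neq\emptyset$. **Theorem.** There are a constant $C(d)>0$ depending only on $d$ and, for all parameters as above, an $$\underline l_0=\underline l_0(\|\mathcal T\|_{r_1},M,J,\alpha,\tau,\xi,\tau',\delta,p,r_1,s_0,d)>0$$ (the choice of $C_0(s_0)$ being fixed with $s_0$; in particular $\underline l_0$ does not depend on $\lambda$, $\mu$ or $I$) such that the following holds for all $l\in\mathbb N$ with $l\ge\underline l_0$ and $L=[l^\alpha]$ (integer part). If * (P1) $\mathbb P(\exists E\in I$ such that both $\Lambda_l(m)$ and $\Lambda_l(n)$ are $(E,\delta)$-bad$)\le l^{-2p}$ for all $|m-n|>2l$,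 and * (P2) $\mathbb P\big(\mathrm{dist}(\sigma(H_{\Lambda_L(m)}),\sigma(H_{\Lambda_L(n)}))\le 2L^{-\tau}\big)\le L^{-2p}/2$ for all $|m-n|>2L$, then for all $|m-n|>2L$ $$\mathbb P\Big(\exists E\in I\text{ such that both }\Lambda_L(m)\text{ and }\Lambda_L(n)\text{ are }\big(E,\tfrac{1+\xi}{\alpha}\big)\text{-bad}\Big)\le C(d)\,L^{-J(\alpha^{-1}p-d)}+\tfrac12L^{-2p}.$$ -/

import Mathlib

open Set MeasureTheory ProbabilityTheory
open scoped ENNReal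

noncomputable section

namespace LongRange

/-- The lattice `ℤ^d`. Its norm `‖·‖` is the supremum norm `|n| = max_i |n_i|`. -/
abbrev ZLat (d : ℕ) : Type := Fin d → ℤ

/-- `⟨k⟩ = max {1, |k|}`. -/
def bracket {d : ℕ} (k : ZLat d) : ℝ := max 1 ‖k‖

/-! ### Sobolev norms -/

/-- The sequence `u` has finite Sobolev norm of order `s`. -/
def MemSobolev {d : ℕ} (s : ℝ) (u : ZLat d → ℂ) : Prop :=
  Summable fun k => ‖u k‖ ^ 2 * bracket k ^ (2 * s)

/-- `‖u‖_s`, where `‖u‖_s ^ 2 = C₀ ∑_k |u(k)|^2 ⟨k⟩^{2s}`. -/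
def seqSobolevNorm {d : ℕ} (C₀ s : ℝ) (u : ZLat d → ℂ) : ℝ :=
  Real.sqrt (C₀ * ∑' k, ‖u k‖ ^ 2 * bracket k ^ (2 * s))

/-- Convolution of sequences, `(u₁ u₂)(k) = ∑_{k'} u₁(k - k') u₂(k')`. -/
def conv {d : ℕ} (u₁ u₂ : ZLat d → ℂ) (k : ZLat d) : ℂ :=
  ∑' k', u₁ (k - k') * u₂ k'

/-- `C₀ > 0` is an admissible normalization constant `C₀(s₀)` of the Sobolev norms: for all
`s ≥ s₀`, `‖u₁ u₂‖_s ≤ (1/2) ‖u₁‖_{s₀} ‖u₂‖_s + C(s) ‖u₁‖_s ‖u₂‖_{s₀}` with some `C(s) > 0`,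
and `C(s₀) = 1/2`. -/
def IsSobolevConst (d : ℕ) (s₀ C₀ : ℝ) : Prop :=
  0 < C₀ ∧ ∀ s : ℝ, s₀ ≤ s → ∃ Cs : ℝ, 0 < Cs ∧ (s = s₀ → Cs = 1 / 2) ∧
    ∀ u₁ u₂ : ZLat d → ℂ, MemSobolev s u₁ → MemSobolev s u₂ →
      MemSobolev s (conv u₁ u₂) ∧
      seqSobolevNorm C₀ s (conv u₁ u₂) ≤
        1 / 2 * seqSobolevNorm C₀ s₀ u₁ * seqSobolevNorm C₀ s u₂
          + Cs * seqSobolevNorm C₀ s u₁ * seqSobolevNorm C₀ s₀ u₂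

/-- The Sobolev norm of a matrix with rows in `X₁` and columns in `X₂`:
`‖M‖_s ^ 2 = C₀ ∑_{k ∈ X₁ - X₂} (sup_{k₁ - k₂ = k} |M(k₁, k₂)|)^2 ⟨k⟩^{2s}`.
(For `k ∉ X₁ - X₂` the supremum is over the empty set, hence `0`.) -/
def matSobolevNorm {d : ℕ} (C₀ s : ℝ) {X₁ X₂ : Set (ZLat d)} (A : Matrix X₁ X₂ ℂ) : ℝ :=
  Real.sqrt (C₀ * ∑' k : ZLat d,
    (⨆ x : {x : X₁ × X₂ // (x.1 : ZLat d) - (x.2 : ZLat d) = k}, ‖A x.1.1 x.1.2‖) ^ 2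
      * bracket k ^ (2 * s))

/-! ### The operators -/

/-- The polynomial hopping matrix: `|m - n|^{-r}` for `m ≠ n`, and `0` on the diagonal. -/
def hopping (d : ℕ) (r : ℝ) : Matrix (ZLat d) (ZLat d) ℂ :=
  fun m n => if m = n then 0 else ((‖m - n‖ ^ (-r) : ℝ) : ℂ)

/-- The matrix of `H = lam⁻¹ T + v(n) δ_{n n'}`. -/
def hamiltonian (d : ℕ) (r lam : ℝ) (v : ZLat d → ℝ) : Matrix (ZLat d) (ZLat d) ℂ :=
  ((lam⁻¹ : ℝ) : ℂ) • hopping d r + Matrix.diagonal fun n => (v n : ℂ)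

/-- The restriction `R_X A R_X` as a matrix indexed by `X`. -/
def restrict {d : ℕ} (A : Matrix (ZLat d) (ZLat d) ℂ) (X : Set (ZLat d)) :
    Matrix X X ℂ :=
  A.submatrix (fun k => (k : ZLat d)) (fun k => (k : ZLat d))

/-- The cube `Λ_L(n) = {k : |k - n| ≤ L}`. -/
def cube {d : ℕ} (L : ℕ) (n : ZLat d) : Set (ZLat d) := {k | ‖k - n‖ ≤ (L : ℝ)}

theorem cube_finite {d : ℕ} (L : ℕ) (n : ZLat d) : (cube L n).Finite := by
  have h : cube L n = Metric.closedBall n (L : ℝ) := by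
    ext k
    simp [cube, dist_eq_norm]
  rw [h]
  exact (isCompact_closedBall n (L : ℝ)).finite_of_discrete

instance {d : ℕ} (L : ℕ) (n : ZLat d) : Fintype (cube L n) := (cube_finite L n).fintype

/-- The Green's function `(H_Λ - E)⁻¹` of a cube `Λ = Λ_L(n)`, meaningful if `H_Λ - E` is
invertible. -/
def green {d : ℕ} (H : Matrix (ZLat d) (ZLat d) ℂ) (L : ℕ) (n : ZLat d) (E : ℝ) :
    Matrix (cube L n) (cube L n) ℂ :=
  (restrict H (cube L n) - (E : ℂ) • 1)⁻¹

/-- The cube `Λ_L(n)` is `(E, δ)`-good for `H`: the Green's function exists and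
`‖G(E)‖_s ≤ L^{τ' + δ s}` for all `s ∈ [s₀, r₁]`. -/
def IsGood {d : ℕ} (C₀ s₀ r₁ τ' : ℝ) (H : Matrix (ZLat d) (ZLat d) ℂ)
    (E δ : ℝ) (L : ℕ) (n : ZLat d) : Prop :=
  IsUnit (restrict H (cube L n) - (E : ℂ) • 1) ∧
    ∀ s ∈ Icc s₀ r₁, matSobolevNorm C₀ s (green H L n E) ≤ (L : ℝ) ^ (τ' + δ * s)

/-- Both cubes `Λ_L(m)` and `Λ_L(n)` are `(E, δ)`-bad, for some common energy `E ∈ I`. -/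
def BothBad {d : ℕ} (C₀ s₀ r₁ τ' : ℝ) (H : Matrix (ZLat d) (ZLat d) ℂ)
    (I : Set ℝ) (δ : ℝ) (L : ℕ) (m n : ZLat d) : Prop :=
  ∃ E ∈ I, ¬ IsGood C₀ s₀ r₁ τ' H E δ L m ∧ ¬ IsGood C₀ s₀ r₁ τ' H E δ L n

/-- `dist(A, B) = inf {|a - b| : a ∈ A, b ∈ B}`. -/
def setDist (A B : Set ℂ) : ℝ := sInf (Set.image2 dist A B)

/-! ### The hopping operator on `ℓ²(ℤ^d)` -/

/-- `ℓ²(ℤ^d)`. -/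
abbrev L2 (d : ℕ) := lp (fun _ : ZLat d => ℂ) 2

theorem memlp_translate {d : ℕ} (k : ZLat d) (u : L2 d) :
    Memℓp (fun m : ZLat d => u (m - k)) 2 := by
  have h := (lp.memℓp u).summable (by norm_num)
  exact memℓp_gen ((Equiv.subRight k).summable_iff.mpr h)

/-- The translation `(S_k u)(m) = u(m - k)` on `ℓ²(ℤ^d)`. -/
def translate {d : ℕ} (k : ZLat d) : L2 d →ₗᵢ[ℂ] L2 d where
  toFun u := ⟨fun m => u (m - k), memlp_translate k u⟩
  map_add' _ _ := rfl
  map_smul' _ _ := rfl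
  norm_map' u := by
    rw [lp.norm_eq_tsum_rpow (by norm_num), lp.norm_eq_tsum_rpow (by norm_num)]
    congr 1
    exact (Equiv.subRight k).tsum_eq (fun m => ‖u m‖ ^ (2 : ℝ≥0∞).toReal)

/-- The hopping operator `T` on `ℓ²(ℤ^d)`, written as the norm convergent series
`∑_k T(k, 0) S_k`; it acts by `(T u)(m) = ∑_n T(m, n) u(n)`, see `hoppingOp_apply`. -/
def hoppingOp (d : ℕ) (r : ℝ) : L2 d →L[ℂ] L2 d :=
  ∑' k : ZLat d, hopping d r k 0 • (translate k).toContinuousLinearMap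

theorem summable_norm_rpow (d : ℕ) {r : ℝ} (hr : (d : ℝ) < r) :
    Summable fun k : ZLat d => ‖k‖ ^ (-r) := by
  let b := Pi.basisFun ℝ (Fin d)
  let Λ := Submodule.span ℤ (Set.range b)
  have hrank : Module.finrank ℤ Λ = d := by
    rw [ZLattice.rank ℝ Λ]; simp
  have hs := ZLattice.summable_norm_rpow Λ (-r) (by rw [hrank]; linarith)
  have hmem : ∀ k : ZLat d, (fun i => (k i : ℝ)) ∈ Λ := by
    intro k
    have : (fun i => (k i : ℝ)) = ∑ i, k i • b i := by
      ext j
      simp [b, Finset.sum_apply, Pi.single_apply]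
    rw [this]
    exact Submodule.sum_mem _ fun i _ =>
      Submodule.smul_mem _ _ (Submodule.subset_span ⟨i, rfl⟩)
  let f : ZLat d → Λ := fun k => ⟨fun i => (k i : ℝ), hmem k⟩
  have hf : Function.Injective f := by
    intro k k' h
    ext i
    have := congrFun (congrArg Subtype.val h) i
    simpa [f] using this
  refine (hs.comp_injective hf).congr fun k => ?_
  have : ‖f k‖ = ‖k‖ := by
    change ‖(fun i => (k i : ℝ))‖ = ‖k‖
    simp only [Pi.norm_def]
    congr 2
  simp only [Function.comp_apply, this]

theorem norm_hopping_zero_le (d : ℕ) (r : ℝ) (k : ZLat d) :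
    ‖hopping d r k 0‖ ≤ ‖k‖ ^ (-r) := by
  unfold hopping
  split_ifs
  · simp; positivity
  · rw [Complex.norm_real, sub_zero, Real.norm_of_nonneg (by positivity)]

theorem hoppingOp_summable (d : ℕ) {r : ℝ} (hr : (d : ℝ) < r) :
    Summable fun k : ZLat d =>
      hopping d r k 0 • (translate (d := d) k).toContinuousLinearMap := by
  refine Summable.of_norm_bounded (summable_norm_rpow d hr) fun k => ?_
  rw [norm_smul]
  calc _ ≤ ‖hopping d r k 0‖ * 1 := by
        gcongr
        exact (translate k).norm_toContinuousLinearMap_le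
    _ ≤ _ := by rw [mul_one]; exact norm_hopping_zero_le d r k

/-- For `r > d` the operator `hoppingOp d r` is the one given by the matrix `hopping d r`. -/
theorem hoppingOp_apply (d : ℕ) {r : ℝ} (hr : (d : ℝ) < r) (u : L2 d) (m : ZLat d) :
    HasSum (fun n => hopping d r m n * u n) (hoppingOp d r u m) := by
  have h1 := (hoppingOp_summable d hr).hasSum.mapL (ContinuousLinearMap.apply ℂ (L2 d) u)
  have h2 := h1.mapL (lp.evalCLM ℂ (fun _ : ZLat d => ℂ) 2 m)
  have h3 := (Equiv.subLeft m).hasSum_iff.mpr h2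
  have e : (fun n => hopping d r m n * u n) =
      fun n => hopping d r (m - n) 0 * u (m - (m - n)) := by
    funext n
    simp [hopping, sub_eq_zero]
  rw [e]
  exact h3

end LongRange

end

/-! The theorem is one multiscale step, carried out in tame Sobolev norms. Deterministic half
(`exists_isGood_of_few_bad`): a cube of radius L is good as soon as it has fewer than J separated
bad l-subcubes and E is at distance at least L^{-τ} from its spectrum. Write A = H_Λ − E, G = A⁻¹,
and let R project onto the set B of sites whose assigned l-subcube is bad. Gluing rows of small
Green's functions at the good sites gives S with S A + R = 1 + P. Here P lives at distance at least
l from the diagonal, hence is small in the s₀ norm. With F = (1 + P)⁻¹ one gets G = F S + F R G, so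
only the rows of G in B remain. Put M = A F R and Q = 1 − A F S; then R G M = R and M R G = Q. The
set B splits into clusters of size O(l^{1+ξ}) at mutual distance at least l^{1+ξ}. Let Y be G cut
down to rows in B and to the diagonal blocks of the clusters. Then Y M = R + Z, where Z comes from
the far off-diagonal blocks of M and is small, and so R G = (1 + Z)⁻¹ Y Q (`blockCut_mul`,
`sobNorm_inverse_le`). The spectral gap bounds the entries of Y by L^τ, and Y is banded, so its
Sobolev norms are controlled too. The first parameter inequality makes P small, the first two
together make Z small, and the third compares the final exponent with goodness at scale L.
Probabilistic half (`measureReal_exists_allBad_le`): outside the event of (P2), every E is far from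
the spectrum of one of the two cubes. If both are bad at E, one of them contains J separated l-cubes
that are bad at E. Splitting these into J/2 independent pairs and using (P1) gives l^{-pJ} per
configuration, and there are at most e^{3^d} L^{dJ} configurations. -/

namespace LongRange

/-! ### Sobolev norms of matrices and the tame product estimate. -/

section Norms

variable {d : ℕ} {X : Set (ZLat d)}

theorem one_le_bracket (k : ZLat d) : 1 ≤ bracket k := le_max_left _ _

theorem bracket_pos (k : ZLat d) : 0 < bracket k := one_pos.trans_le (one_le_bracket k)

theorem bracket_add_le (j k : ZLat d) : bracket (j + k) ≤ 2 * max (bracket j) (bracket k) := by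
  have h1 := le_max_left (bracket j) (bracket k)
  have h2 := le_max_right (bracket j) (bracket k)
  have h3 := one_le_bracket j
  have h4 : ‖j‖ ≤ bracket j := le_max_right _ _
  have h5 : ‖k‖ ≤ bracket k := le_max_right _ _
  have h6 := norm_add_le j k
  refine max_le ?_ ?_ <;> linarith

theorem bracket_add_rpow_le (j k : ZLat d) {s : ℝ} (hs : 0 ≤ s) :
    bracket (j + k) ^ s ≤ 2 ^ s * (bracket j ^ s + bracket k ^ s) := by
  have hj := Real.rpow_nonneg (bracket_pos j).le s
  have hk := Real.rpow_nonneg (bracket_pos k).le s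
  calc bracket (j + k) ^ s ≤ (2 * max (bracket j) (bracket k)) ^ s :=
        Real.rpow_le_rpow (bracket_pos _).le (bracket_add_le j k) hs
    _ = 2 ^ s * max (bracket j) (bracket k) ^ s :=
        Real.mul_rpow (by norm_num) ((bracket_pos j).le.trans (le_max_left _ _))
    _ ≤ 2 ^ s * (bracket j ^ s + bracket k ^ s) := by
        gcongr
        rcases max_choice (bracket j) (bracket k) with h | h <;> rw [h] <;> linarith

/-- The largest modulus of an entry of `A` on the diagonal `k₁ - k₂ = k`. -/
noncomputable def diagSup (A : Matrix X X ℂ) (k : ZLat d) : ℝ :=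
  ⨆ x : {x : X × X // (x.1 : ZLat d) - (x.2 : ZLat d) = k}, ‖A x.1.1 x.1.2‖

theorem diagSup_nonneg (A : Matrix X X ℂ) (k : ZLat d) : 0 ≤ diagSup A k :=
  Real.iSup_nonneg fun _ => norm_nonneg _

theorem diagSup_le (A : Matrix X X ℂ) (k : ZLat d) {c : ℝ} (hc : 0 ≤ c)
    (h : ∀ x y : X, (x : ZLat d) - (y : ZLat d) = k → ‖A x y‖ ≤ c) : diagSup A k ≤ c :=
  Real.iSup_le (fun x => h _ _ x.2) hc

/-- A real supremum over an unbounded family is 0 by default, hence the bound along the diagonal.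
This form also serves infinite index sets such as the whole lattice. -/
theorem le_diagSup_of_le (A : Matrix X X ℂ) {c : ℝ} (x y : X)
    (h : ∀ x' y' : X, (x' : ZLat d) - y' = (x : ZLat d) - (y : ZLat d) → ‖A x' y'‖ ≤ c) :
    ‖A x y‖ ≤ diagSup A (x - y) :=
  le_ciSup (f := fun z : {z : X × X // (z.1 : ZLat d) - (z.2 : ZLat d) = (x : ZLat d) - (y : ZLat d)} =>
    ‖A z.1.1 z.1.2‖) ⟨c, by rintro _ ⟨z, rfl⟩; exact h _ _ z.2⟩ ⟨(x, y), rfl⟩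

theorem le_diagSup [Finite X] (A : Matrix X X ℂ) (x y : X) : ‖A x y‖ ≤ diagSup A (x - y) := by
  obtain ⟨c, hc⟩ := (Set.finite_range fun z : X × X => ‖A z.1 z.2‖).bddAbove
  exact le_diagSup_of_le A x y fun x' y' _ => hc ⟨(x', y'), rfl⟩

theorem diagSup_eq_zero (A : Matrix X X ℂ) (k : ZLat d)
    (h : k ∉ Set.range fun z : X × X => (z.1 : ZLat d) - z.2) : diagSup A k = 0 :=
  le_antisymm (diagSup_le A k le_rfl fun x y hxy => (h ⟨(x, y), hxy⟩).elim) (diagSup_nonneg A k)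

theorem memlp_diagSup [Finite X] (s : ℝ) (A : Matrix X X ℂ) :
    Memℓp (fun k : ZLat d => ((diagSup A k * bracket k ^ s : ℝ) : ℂ)) 2 := by
  refine memℓp_gen (summable_of_hasFiniteSupport ?_)
  refine (Set.finite_range fun z : X × X => (z.1 : ZLat d) - z.2).subset fun k hk => ?_
  by_contra h
  exact hk (by simp [diagSup_eq_zero A k h])

/-- The weighted sequence `k ↦ ⟨k⟩^s sup_{k₁ - k₂ = k} |A(k₁, k₂)|`. -/
noncomputable def weightedSeq [Finite X] (s : ℝ) (A : Matrix X X ℂ) : L2 d :=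
  ⟨_, memlp_diagSup s A⟩

theorem weightedSeq_apply [Finite X] (s : ℝ) (A : Matrix X X ℂ) (k : ZLat d) :
    weightedSeq s A k = ((diagSup A k * bracket k ^ s : ℝ) : ℂ) := rfl

theorem norm_weightedSeq_apply [Finite X] (s : ℝ) (A : Matrix X X ℂ) (k : ZLat d) :
    ‖weightedSeq s A k‖ = diagSup A k * bracket k ^ s := by
  rw [weightedSeq_apply, Complex.norm_real, Real.norm_of_nonneg]
  exact mul_nonneg (diagSup_nonneg A k) (Real.rpow_nonneg (bracket_pos k).le s)

/-- The Sobolev norm of a matrix with the normalization constant `1`. -/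
noncomputable def sobNorm [Finite X] (s : ℝ) (A : Matrix X X ℂ) : ℝ := ‖weightedSeq s A‖

theorem norm_L2_sq (u : L2 d) : ‖u‖ ^ 2 = ∑' k, ‖u k‖ ^ 2 := by
  have := lp.norm_rpow_eq_tsum (p := 2) (by norm_num) u
  simpa using this

theorem sum_sq_le_norm_L2 (u : L2 d) (F : Finset (ZLat d)) : ∑ k ∈ F, ‖u k‖ ^ 2 ≤ ‖u‖ ^ 2 := by
  have := lp.sum_rpow_le_norm_rpow (p := 2) (by norm_num) u F
  simpa using this

theorem bracket_rpow_sq (k : ZLat d) (s : ℝ) : (bracket k ^ s) ^ 2 = bracket k ^ (2 * s) := by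
  rw [← Real.rpow_natCast, ← Real.rpow_mul (bracket_pos k).le]
  congr 1; push_cast; ring

theorem matSobolevNorm_eq [Finite X] {C₀ : ℝ} (hC : 0 ≤ C₀) (s : ℝ) (A : Matrix X X ℂ) :
    matSobolevNorm C₀ s A = Real.sqrt C₀ * sobNorm s A := by
  have h : sobNorm s A ^ 2 = ∑' k, diagSup A k ^ 2 * bracket k ^ (2 * s) := by
    rw [sobNorm, norm_L2_sq]
    refine tsum_congr fun k => ?_
    rw [norm_weightedSeq_apply, mul_pow, bracket_rpow_sq]
  have h2 : matSobolevNorm C₀ s A = Real.sqrt (C₀ * sobNorm s A ^ 2) := by rw [h]; rfl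
  rw [h2, Real.sqrt_mul hC, Real.sqrt_sq (show 0 ≤ sobNorm s A from norm_nonneg _)]

theorem sobNorm_nonneg [Finite X] (s : ℝ) (A : Matrix X X ℂ) : 0 ≤ sobNorm s A := norm_nonneg _

theorem le_weightedSeq [Finite X] (s : ℝ) (A : Matrix X X ℂ) (x y : X) :
    ‖A x y‖ * bracket ((x : ZLat d) - (y : ZLat d)) ^ s ≤ ‖weightedSeq s A ((x : ZLat d) - (y : ZLat d))‖ := by
  rw [norm_weightedSeq_apply]
  exact mul_le_mul_of_nonneg_right (le_diagSup A x y) (Real.rpow_nonneg (bracket_pos _).le s)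

theorem le_sobNorm [Finite X] (s : ℝ) (A : Matrix X X ℂ) (x y : X) :
    ‖A x y‖ * bracket ((x : ZLat d) - (y : ZLat d)) ^ s ≤ sobNorm s A :=
  (le_weightedSeq s A x y).trans (lp.norm_apply_le_norm (by norm_num) _ _)

/-- Comparison principle on which the later norm bounds rest: a supremum along a diagonal inherits
any bound that depends only on x − y, so it is enough to exhibit a dominating ℓ² sequence. -/
theorem sobNorm_le [Finite X] {s : ℝ} {A : Matrix X X ℂ} {u : L2 d}
    (h : ∀ x y : X, ‖A x y‖ * bracket ((x : ZLat d) - (y : ZLat d)) ^ s ≤ ‖u ((x : ZLat d) - (y : ZLat d))‖) :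
    sobNorm s A ≤ ‖u‖ := by
  refine lp.norm_mono (by norm_num) fun k => ?_
  rw [norm_weightedSeq_apply]
  have hb := Real.rpow_pos_of_pos (bracket_pos k) s
  rw [← le_div_iff₀ hb]
  refine diagSup_le A k (by positivity) fun x y hxy => ?_
  rw [le_div_iff₀ hb, ← hxy]
  exact h x y

theorem sobNorm_mono [Finite X] {s : ℝ} {A B : Matrix X X ℂ} (h : ∀ x y, ‖A x y‖ ≤ ‖B x y‖) :
    sobNorm s A ≤ sobNorm s B :=
  sobNorm_le fun x y => (mul_le_mul_of_nonneg_right (h x y)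
    (Real.rpow_nonneg (bracket_pos _).le s)).trans (le_weightedSeq s B x y)

theorem sobNorm_congr [Finite X] {s : ℝ} {A B : Matrix X X ℂ} (h : ∀ x y, ‖A x y‖ = ‖B x y‖) :
    sobNorm s A = sobNorm s B :=
  le_antisymm (sobNorm_mono fun x y => (h x y).le) (sobNorm_mono fun x y => (h x y).ge)

theorem sobNorm_neg [Finite X] (s : ℝ) (A : Matrix X X ℂ) : sobNorm s (-A) = sobNorm s A :=
  sobNorm_congr fun x y => by simp

theorem sobNorm_add_le [Finite X] (s : ℝ) (A B : Matrix X X ℂ) :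
    sobNorm s (A + B) ≤ sobNorm s A + sobNorm s B := by
  refine le_trans (sobNorm_le (u := weightedSeq s A + weightedSeq s B) fun x y => ?_)
    (norm_add_le _ _)
  rw [lp.coeFn_add, Pi.add_apply, weightedSeq_apply, weightedSeq_apply, ← Complex.ofReal_add,
    Complex.norm_real, ← add_mul]
  refine le_trans ?_ (le_abs_self _)
  refine mul_le_mul_of_nonneg_right ?_ (Real.rpow_nonneg (bracket_pos _).le s)
  exact (norm_add_le _ _).trans (add_le_add (le_diagSup A x y) (le_diagSup B x y))

theorem sobNorm_sub_le [Finite X] (s : ℝ) (A B : Matrix X X ℂ) :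
    sobNorm s (A - B) ≤ sobNorm s A + sobNorm s B := by
  rw [sub_eq_add_neg, ← sobNorm_neg s B]
  exact sobNorm_add_le s A (-B)

theorem sobNorm_le_of_exponent_le [Finite X] {s s' : ℝ} (h : s ≤ s') (A : Matrix X X ℂ) :
    sobNorm s A ≤ sobNorm s' A :=
  sobNorm_le fun x y => (mul_le_mul_of_nonneg_left
    (Real.rpow_le_rpow_of_exponent_le (one_le_bracket _) h) (norm_nonneg _)).trans
      (le_weightedSeq s' A x y)

/-- Matrices supported away from the diagonal are small in weak norms. -/
theorem sobNorm_le_of_far [Finite X] {s s' ρ : ℝ} (h : s ≤ s') (hρ : 0 < ρ) (A : Matrix X X ℂ)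
    (hA : ∀ x y : X, A x y ≠ 0 → ρ ≤ ‖(x : ZLat d) - (y : ZLat d)‖) :
    sobNorm s A ≤ ρ ^ (-(s' - s)) * sobNorm s' A := by
  have hc : 0 ≤ ρ ^ (-(s' - s)) := Real.rpow_nonneg hρ.le _
  have h1 : sobNorm s A ≤ ‖((ρ ^ (-(s' - s)) : ℝ) : ℂ) • weightedSeq s' A‖ := by
    refine sobNorm_le fun x y => ?_
    rw [lp.coeFn_smul, Pi.smul_apply, norm_smul, Complex.norm_real, Real.norm_of_nonneg hc]
    by_cases h0 : A x y = 0
    · rw [h0, norm_zero, zero_mul]; positivity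
    refine le_trans ?_ (mul_le_mul_of_nonneg_left (le_weightedSeq s' A x y) hc)
    have hb : ρ ≤ bracket ((x : ZLat d) - (y : ZLat d)) := (hA x y h0).trans (le_max_right _ _)
    have hbp := bracket_pos ((x : ZLat d) - (y : ZLat d))
    have h2 : bracket ((x : ZLat d) - (y : ZLat d)) ^ (-(s' - s)) ≤ ρ ^ (-(s' - s)) :=
      Real.rpow_le_rpow_of_nonpos hρ hb (by linarith)
    have h3 : bracket ((x : ZLat d) - (y : ZLat d)) ^ s =
        bracket ((x : ZLat d) - (y : ZLat d)) ^ (-(s' - s)) * bracket ((x : ZLat d) - (y : ZLat d)) ^ s' := by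
      rw [← Real.rpow_add hbp]; congr 1; ring
    rw [h3]
    calc _ = bracket ((x : ZLat d) - (y : ZLat d)) ^ (-(s' - s)) *
          (‖A x y‖ * bracket ((x : ZLat d) - (y : ZLat d)) ^ s') := by ring
      _ ≤ _ := by gcongr
  rwa [norm_smul, Complex.norm_real, Real.norm_of_nonneg hc] at h1

theorem one_le_norm_of_ne_zero {k : ZLat d} (hk : k ≠ 0) : 1 ≤ ‖k‖ := by
  obtain ⟨i, hi⟩ := Function.ne_iff.mp hk
  refine le_trans ?_ (norm_le_pi_norm k i)
  rw [Int.norm_eq_abs]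
  exact_mod_cast Int.one_le_abs hi

theorem summable_bracket_rpow {r : ℝ} (hr : (d : ℝ) < r) :
    Summable fun k : ZLat d => bracket k ^ (-r) := by
  refine Summable.of_nonneg_of_le (fun k => Real.rpow_nonneg (bracket_pos k).le _)
    (fun k => ?_) ((summable_norm_rpow d hr).add
      (summable_of_hasFiniteSupport (f := fun k : ZLat d => if k = 0 then (1 : ℝ) else 0)
        ((Set.finite_singleton (0 : ZLat d)).subset fun k hk => ?_)))
  · by_cases hk : k = 0
    · subst hk
      simp only [if_true]
      have : bracket (0 : ZLat d) = 1 := by simp [bracket]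
      rw [this, Real.one_rpow]
      have := Real.rpow_nonneg (norm_nonneg (0 : ZLat d)) (-r)
      linarith
    · rw [if_neg hk, add_zero, bracket, max_eq_right (one_le_norm_of_ne_zero hk)]
  · by_contra h
    exact hk (if_neg h)

theorem memlp_bracket {s₀ : ℝ} (h : (d : ℝ) / 2 < s₀) :
    Memℓp (fun k : ZLat d => ((bracket k ^ (-s₀) : ℝ) : ℂ)) 2 := by
  refine memℓp_gen ((summable_bracket_rpow (d := d) (r := 2 * s₀) (by linarith)).congr fun k => ?_)
  have : (2 : ℝ≥0∞).toReal = ((2 : ℕ) : ℝ) := by norm_num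
  rw [this, Real.rpow_natCast, Complex.norm_real, Real.norm_of_nonneg
    (Real.rpow_nonneg (bracket_pos k).le _), bracket_rpow_sq]
  congr 1; ring

/-- The square summable sequence `⟨k⟩^{-s₀}`, for `s₀ > d/2`. -/
noncomputable def bracketSeq {s₀ : ℝ} (h : (d : ℝ) / 2 < s₀) : L2 d := ⟨_, memlp_bracket h⟩

theorem norm_bracketSeq_apply {s₀ : ℝ} (h : (d : ℝ) / 2 < s₀) (k : ZLat d) :
    ‖bracketSeq h k‖ = bracket k ^ (-s₀) := by
  change ‖((bracket k ^ (-s₀) : ℝ) : ℂ)‖ = _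
  rw [Complex.norm_real, Real.norm_of_nonneg (Real.rpow_nonneg (bracket_pos k).le _)]

theorem one_le_norm_bracketSeq {s₀ : ℝ} (h : (d : ℝ) / 2 < s₀) : 1 ≤ ‖bracketSeq h‖ := by
  have h1 := lp.norm_apply_le_norm (p := 2) (by norm_num) (bracketSeq h) (0 : ZLat d)
  rw [norm_bracketSeq_apply] at h1
  simpa [bracket] using h1

/-- Matrices supported near the diagonal with pointwise bounded weighted entries. -/
theorem sobNorm_le_of_near [Finite X] {s s₀ ρ c : ℝ} (h : (d : ℝ) / 2 < s₀) (hρ : 1 ≤ ρ)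
    (hc : 0 ≤ c) (A : Matrix X X ℂ) (hA : ∀ x y : X, A x y ≠ 0 → ‖(x : ZLat d) - (y : ZLat d)‖ ≤ ρ)
    (hb : ∀ x y : X, ‖A x y‖ * bracket ((x : ZLat d) - (y : ZLat d)) ^ s ≤ c) :
    sobNorm s A ≤ c * ρ ^ s₀ * ‖bracketSeq h‖ := by
  have h0 : 0 ≤ s₀ := by have : (0:ℝ) ≤ d := Nat.cast_nonneg d; linarith
  have hcρ : 0 ≤ c * ρ ^ s₀ := by positivity
  have h1 : sobNorm s A ≤ ‖((c * ρ ^ s₀ : ℝ) : ℂ) • bracketSeq h‖ := by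
    refine sobNorm_le fun x y => ?_
    rw [lp.coeFn_smul, Pi.smul_apply, norm_smul, Complex.norm_real, Real.norm_of_nonneg hcρ,
      norm_bracketSeq_apply]
    have hbp := bracket_pos ((x : ZLat d) - (y : ZLat d))
    by_cases h00 : A x y = 0
    · rw [h00, norm_zero, zero_mul]; positivity
    have h2 : bracket ((x : ZLat d) - (y : ZLat d)) ≤ ρ := max_le hρ (hA x y h00)
    -- Inside the band this product is at least 1, so a constant bound can be traded for the ℓ²
    -- sequence ⟨k⟩^{-s₀} at the price ρ^{s₀}.
    have h3 : 1 ≤ ρ ^ s₀ * bracket ((x : ZLat d) - (y : ZLat d)) ^ (-s₀) := by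
      rw [Real.rpow_neg hbp.le, ← div_eq_mul_inv, one_le_div (Real.rpow_pos_of_pos hbp _)]
      exact Real.rpow_le_rpow hbp.le h2 h0
    calc _ ≤ c * 1 := by rw [mul_one]; exact hb x y
      _ ≤ c * (ρ ^ s₀ * bracket ((x : ZLat d) - (y : ZLat d)) ^ (-s₀)) := by gcongr
      _ = _ := by ring
  rwa [norm_smul, Complex.norm_real, Real.norm_of_nonneg hcρ] at h1

theorem sobNorm_le_of_near_of_le [Finite X] {s s₀ ρ c : ℝ} (h : (d : ℝ) / 2 < s₀) (hs : 0 ≤ s)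
    (hρ : 1 ≤ ρ) (hc : 0 ≤ c) (A : Matrix X X ℂ)
    (hA : ∀ x y : X, A x y ≠ 0 → ‖(x : ZLat d) - (y : ZLat d)‖ ≤ ρ) (hb : ∀ x y : X, ‖A x y‖ ≤ c) :
    sobNorm s A ≤ c * ρ ^ (s + s₀) * ‖bracketSeq h‖ := by
  have h1 := sobNorm_le_of_near (c := c * ρ ^ s) (s := s) h hρ (by positivity) A hA fun x y => by
    by_cases h00 : A x y = 0
    · rw [h00, norm_zero, zero_mul]; positivity
    exact mul_le_mul (hb x y) (Real.rpow_le_rpow (bracket_pos _).le (max_le hρ (hA x y h00)) hs)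
      (Real.rpow_nonneg (bracket_pos _).le _) hc
  rwa [mul_assoc c, ← Real.rpow_add (by linarith)] at h1

/-- Cauchy–Schwarz against ⟨k⟩^{-s₀}: since s₀ > d/2, the s₀ norm controls an ℓ¹ norm along the
diagonals. -/
theorem sum_diagSup_le [Finite X] {s₀ : ℝ} (h : (d : ℝ) / 2 < s₀) (A : Matrix X X ℂ)
    (F : Finset (ZLat d)) : ∑ k ∈ F, diagSup A k ≤ ‖bracketSeq h‖ * sobNorm s₀ A := by
  have h1 : ∑ k ∈ F, diagSup A k =
      ∑ k ∈ F, ‖bracketSeq h k‖ * ‖weightedSeq s₀ A k‖ := by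
    refine Finset.sum_congr rfl fun k _ => ?_
    rw [norm_bracketSeq_apply, norm_weightedSeq_apply, mul_comm, mul_assoc,
      ← Real.rpow_add (bracket_pos k)]
    simp
  rw [h1]
  refine abs_le_of_sq_le_sq' ?_ (mul_nonneg (norm_nonneg _) (norm_nonneg _)) |>.2
  refine (Finset.sum_mul_sq_le_sq_mul_sq _ _ _).trans ?_
  rw [mul_pow]
  exact mul_le_mul (sum_sq_le_norm_L2 _ F) (sum_sq_le_norm_L2 _ F)
    (Finset.sum_nonneg fun _ _ => sq_nonneg _) (sq_nonneg _)

theorem sobNorm_one_le [Finite X] [DecidableEq X] (s : ℝ) : sobNorm s (1 : Matrix X X ℂ) ≤ 1 := by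
  have h := lp.norm_single (E := fun _ : ZLat d => ℂ) (p := 2) (by norm_num) 0 1
  rw [norm_one] at h
  rw [← h]
  refine sobNorm_le fun x y => ?_
  by_cases hxy : x = y
  · subst hxy
    simp [bracket]
  · rw [Matrix.one_apply_ne hxy, norm_zero, zero_mul]; exact norm_nonneg _

theorem sobNorm_diagonal_le [Finite X] [DecidableEq X] (s : ℝ) (v : X → ℂ) {c : ℝ} (hc : 0 ≤ c)
    (hv : ∀ x, ‖v x‖ ≤ c) : sobNorm s (Matrix.diagonal v) ≤ c := by
  have h := lp.norm_single (E := fun _ : ZLat d => ℂ) (p := 2) (by norm_num) 0 (c : ℂ)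
  rw [Complex.norm_real, Real.norm_of_nonneg hc] at h
  rw [← h]
  refine sobNorm_le fun x y => ?_
  by_cases hxy : x = y
  · subst hxy
    simpa [bracket, abs_of_nonneg hc] using hv x
  · rw [Matrix.diagonal_apply_ne _ hxy, norm_zero, zero_mul]; exact norm_nonneg _

theorem norm_sum_translate_le [Finite X] {s₀ : ℝ} (h : (d : ℝ) / 2 < s₀) (A : Matrix X X ℂ)
    (u : L2 d) (F : Finset (ZLat d)) :
    ‖∑ k ∈ F, ((diagSup A k : ℝ) : ℂ) • translate k u‖ ≤
      ‖bracketSeq h‖ * sobNorm s₀ A * ‖u‖ := by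
  refine (norm_sum_le _ _).trans ?_
  refine le_trans (Finset.sum_le_sum fun k _ => (?_ : _ ≤ diagSup A k * ‖u‖)) ?_
  · rw [norm_smul, LinearIsometry.norm_map, Complex.norm_real,
      Real.norm_of_nonneg (diagSup_nonneg A k)]
  · rw [← Finset.sum_mul]
    exact mul_le_mul_of_nonneg_right (sum_diagSup_le h A F) (norm_nonneg _)

theorem sum_translate_weightedSeq_apply [Finite X] (s : ℝ) (A B : Matrix X X ℂ)
    (F : Finset (ZLat d)) (k : ZLat d) :
    (∑ j ∈ F, ((diagSup A j : ℝ) : ℂ) • translate j (weightedSeq s B) : L2 d) k =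
      ((∑ j ∈ F, diagSup A j * (diagSup B (k - j) * bracket (k - j) ^ s) : ℝ) : ℂ) := by
  rw [lp.coeFn_sum, Finset.sum_apply, Complex.ofReal_sum]
  refine Finset.sum_congr rfl fun j _ => ?_
  rw [lp.coeFn_smul, Pi.smul_apply, smul_eq_mul, Complex.ofReal_mul]
  rfl

/-- A matrix dominated entrywise by a product satisfies the tame product estimate. -/
theorem sobNorm_le_of_le_mul [Fintype X] {s s₀ : ℝ} (h : (d : ℝ) / 2 < s₀) (hs : 0 ≤ s)
    (A B D : Matrix X X ℂ) (hD : ∀ x y, ‖D x y‖ ≤ ∑ z, ‖A x z‖ * ‖B z y‖) :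
    sobNorm s D ≤ 2 ^ s * ‖bracketSeq h‖ *
      (sobNorm s A * sobNorm s₀ B + sobNorm s₀ A * sobNorm s B) := by
  classical
  set F : Finset (ZLat d) := Finset.univ.image fun z : X × X => (z.1 : ZLat d) - z.2 with hF
  -- Since ⟨x−y⟩^s ≤ 2^s(⟨x−z⟩^s + ⟨z−y⟩^s), the weight falls on one factor at a time. The other
  -- factor enters only through its ℓ¹ norm, as coefficients of a sum of translates; this is Young's
  -- inequality.
  set u₁ : L2 d := ∑ j ∈ F, ((diagSup A j : ℝ) : ℂ) • translate j (weightedSeq s B) with hu₁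
  set u₂ : L2 d := ∑ j ∈ F, ((diagSup B j : ℝ) : ℂ) • translate j (weightedSeq s A) with hu₂
  have hmem : ∀ x y : X, (x : ZLat d) - (y : ZLat d) ∈ F := fun x y =>
    Finset.mem_image.mpr ⟨(x, y), Finset.mem_univ _, rfl⟩
  have hnn : ∀ (A B : Matrix X X ℂ) (j k : ZLat d),
      0 ≤ diagSup A j * (diagSup B (k - j) * bracket (k - j) ^ s) := fun A B j k =>
    mul_nonneg (diagSup_nonneg _ _) (mul_nonneg (diagSup_nonneg _ _)
      (Real.rpow_nonneg (bracket_pos _).le _))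
  have key : sobNorm s D ≤ ‖((2 ^ s : ℝ) : ℂ) • (u₁ + u₂)‖ := by
    refine sobNorm_le fun x y => ?_
    rw [lp.coeFn_smul, Pi.smul_apply, norm_smul, Complex.norm_real,
      Real.norm_of_nonneg (by positivity), lp.coeFn_add, Pi.add_apply, hu₁, hu₂,
      sum_translate_weightedSeq_apply, sum_translate_weightedSeq_apply, ← Complex.ofReal_add,
      Complex.norm_real]
    refine le_trans ?_ (mul_le_mul_of_nonneg_left (le_abs_self _) (by positivity))
    have e1 : ∑ z : X, diagSup A (x - z) * (diagSup B (z - y) * bracket ((z : ZLat d) - (y : ZLat d)) ^ s) ≤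
        ∑ j ∈ F, diagSup A j * (diagSup B ((x : ZLat d) - (y : ZLat d) - j) *
          bracket ((x : ZLat d) - (y : ZLat d) - j) ^ s) := by
      have hinj : Function.Injective fun z : X => (x : ZLat d) - (z : ZLat d) := fun z z' hz =>
        Subtype.ext (sub_right_injective hz)
      refine le_trans (le_of_eq ?_) (Finset.sum_le_sum_of_subset_of_nonneg
        (s := Finset.univ.image fun z : X => (x : ZLat d) - (z : ZLat d)) ?_ fun j _ _ => hnn _ _ _ _)
      · rw [Finset.sum_image hinj.injOn]
        refine Finset.sum_congr rfl fun z _ => ?_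
        rw [show (x : ZLat d) - (y : ZLat d) - (x - z) = z - y by abel]
      · intro j hj
        obtain ⟨z, -, rfl⟩ := Finset.mem_image.mp hj
        exact hmem x z
    have e2 : ∑ z : X, diagSup B (z - y) * (diagSup A (x - z) * bracket ((x : ZLat d) - (z : ZLat d)) ^ s) ≤
        ∑ j ∈ F, diagSup B j * (diagSup A ((x : ZLat d) - (y : ZLat d) - j) *
          bracket ((x : ZLat d) - (y : ZLat d) - j) ^ s) := by
      have hinj : Function.Injective fun z : X => (z : ZLat d) - (y : ZLat d) := fun z z' hz =>
        Subtype.ext (sub_left_injective hz)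
      refine le_trans (le_of_eq ?_) (Finset.sum_le_sum_of_subset_of_nonneg
        (s := Finset.univ.image fun z : X => (z : ZLat d) - (y : ZLat d)) ?_ fun j _ _ => hnn _ _ _ _)
      · rw [Finset.sum_image hinj.injOn]
        refine Finset.sum_congr rfl fun z _ => ?_
        rw [show (x : ZLat d) - (y : ZLat d) - (z - y) = x - z by abel]
      · intro j hj
        obtain ⟨z, -, rfl⟩ := Finset.mem_image.mp hj
        exact hmem z y
    refine le_trans ?_ (mul_le_mul_of_nonneg_left (add_le_add e1 e2) (by positivity))
    refine (mul_le_mul_of_nonneg_right (hD x y) (Real.rpow_nonneg (bracket_pos _).le s)).trans ?_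
    rw [← Finset.sum_add_distrib, Finset.sum_mul, Finset.mul_sum]
    refine Finset.sum_le_sum fun z _ => ?_
    have hb := bracket_add_rpow_le ((x : ZLat d) - (z : ZLat d)) ((z : ZLat d) - (y : ZLat d)) hs
    rw [sub_add_sub_cancel] at hb
    calc _ ≤ (diagSup A (x - z) * diagSup B (z - y)) *
          (2 ^ s * (bracket ((x : ZLat d) - (z : ZLat d)) ^ s + bracket ((z : ZLat d) - (y : ZLat d)) ^ s)) := by
          refine mul_le_mul (mul_le_mul (le_diagSup A x z) (le_diagSup B z y) (norm_nonneg _)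
            (diagSup_nonneg _ _)) hb (Real.rpow_nonneg (bracket_pos _).le s)
            (mul_nonneg (diagSup_nonneg _ _) (diagSup_nonneg _ _))
      _ = _ := by ring
  rw [norm_smul, Complex.norm_real, Real.norm_of_nonneg (by positivity)] at key
  refine key.trans ?_
  rw [mul_assoc]
  refine mul_le_mul_of_nonneg_left ?_ (by positivity)
  refine (norm_add_le _ _).trans ?_
  have h1 := norm_sum_translate_le h A (weightedSeq s B) F
  have h2 := norm_sum_translate_le h B (weightedSeq s A) F
  have e1 : ‖weightedSeq s A‖ = sobNorm s A := rfl
  have e2 : ‖weightedSeq s B‖ = sobNorm s B := rfl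
  rw [e2] at h1; rw [e1] at h2
  calc ‖u₁‖ + ‖u₂‖ ≤ _ := add_le_add h1 h2
    _ = _ := by ring

theorem sobNorm_mul_le [Fintype X] {s s₀ : ℝ} (h : (d : ℝ) / 2 < s₀) (hs : 0 ≤ s)
    (A B : Matrix X X ℂ) :
    sobNorm s (A * B) ≤ 2 ^ s * ‖bracketSeq h‖ *
      (sobNorm s A * sobNorm s₀ B + sobNorm s₀ A * sobNorm s B) :=
  sobNorm_le_of_le_mul h hs A B _ fun x y => by
    rw [Matrix.mul_apply]
    exact (norm_sum_le _ _).trans (Finset.sum_le_sum fun z _ => norm_mul_le _ _)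

theorem eq_zero_of_sobNorm_eq_zero [Finite X] {s : ℝ} {A : Matrix X X ℂ} (h : sobNorm s A = 0) :
    A = 0 := by
  ext x y
  have h1 := le_sobNorm s A x y
  have h2 := Real.rpow_pos_of_pos (bracket_pos ((x : ZLat d) - (y : ZLat d))) s
  rw [h] at h1
  have h3 : ‖A x y‖ ≤ 0 := by
    by_contra! h4
    exact absurd h1 (not_le.mpr (mul_pos h4 h2))
  simpa using h3

/-- A column of a matrix is bounded in `ℓ²` by any nonnegative order Sobolev norm. -/
theorem sum_norm_sq_col_le [Fintype X] {s : ℝ} (hs : 0 ≤ s) (A : Matrix X X ℂ) (y : X) :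
    ∑ x, ‖A x y‖ ^ 2 ≤ sobNorm s A ^ 2 := by
  classical
  refine le_trans ?_ (sum_sq_le_norm_L2 (weightedSeq s A)
    (Finset.univ.image fun x : X => (x : ZLat d) - (y : ZLat d)))
  rw [Finset.sum_image (fun x _ x' _ hx => Subtype.ext (sub_left_injective hx))]
  refine Finset.sum_le_sum fun x _ => ?_
  gcongr
  refine le_trans ?_ (le_weightedSeq s A x y)
  exact le_mul_of_one_le_right (norm_nonneg _) (Real.one_le_rpow (one_le_bracket _) hs)

end Norms

/-! ### Algebra and estimates of the coupling step, with abstract bounds. -/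

section Coupling

theorem two_add_le_of_le {k σ p f : ℝ} (hk : 1 ≤ k) (hσ : 1 ≤ σ) (hp : p ≤ k * σ)
    (hf : f ≤ 2 + 4 * k * p) : f ≤ 6 * k ^ 2 * σ := by
  calc f ≤ 2 + 4 * k * (k * σ) := hf.trans (by gcongr)
    _ = 2 * (1 * 1) + 4 * (k ^ 2 * σ) := by ring
    _ ≤ 2 * (k ^ 2 * σ) + 4 * (k ^ 2 * σ) := by gcongr; exact one_le_pow₀ hk
    _ = _ := by ring

variable {d : ℕ} {X : Set (ZLat d)}

/-- The matrix `G` with the entries outside the rows in `B` and outside the diagonal blocks of the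
labelling `c` removed. -/
noncomputable def blockCut {ι : Type*} [DecidableEq ι] (B : X → Prop) [DecidablePred B] (c : X → ι)
    (G : Matrix X X ℂ) : Matrix X X ℂ :=
  fun x y => if B x ∧ c x = c y then G x y else 0

/-- The off-diagonal blocks of `M` with respect to the labelling `c`. -/
noncomputable def offBlock {ι : Type*} [DecidableEq ι] (c : X → ι) (M : Matrix X X ℂ) :
    Matrix X X ℂ :=
  fun x y => if c x = c y then 0 else M x y

theorem norm_blockCut_le {ι : Type*} [DecidableEq ι] (B : X → Prop) [DecidablePred B] (c : X → ι)
    (G : Matrix X X ℂ) (x y : X) : ‖blockCut B c G x y‖ ≤ ‖G x y‖ := by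
  unfold blockCut
  split_ifs <;> simp

theorem norm_offBlock_le {ι : Type*} [DecidableEq ι] (c : X → ι) (M : Matrix X X ℂ) (x y : X) :
    ‖offBlock c M x y‖ ≤ ‖M x y‖ := by
  unfold offBlock
  split_ifs <;> simp

variable [Fintype X]

theorem sobNorm_mul_le_of_le {s s₀ κ : ℝ} (h : (d : ℝ) / 2 < s₀) (hs : 0 ≤ s)
    (hκ : 2 ^ s * ‖bracketSeq h‖ ≤ κ) {A B : Matrix X X ℂ} {a a₀ b b₀ : ℝ}
    (hA : sobNorm s A ≤ a) (hA₀ : sobNorm s₀ A ≤ a₀) (hB : sobNorm s B ≤ b)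
    (hB₀ : sobNorm s₀ B ≤ b₀) : sobNorm s (A * B) ≤ κ * (a * b₀ + a₀ * b) := by
  have h1 := sobNorm_nonneg s A
  have h2 := sobNorm_nonneg s₀ A
  have h3 := sobNorm_nonneg s B
  have h4 := sobNorm_nonneg s₀ B
  refine (sobNorm_mul_le h hs A B).trans ?_
  have h5 : 0 ≤ 2 ^ s * ‖bracketSeq h‖ := by positivity
  have h6 := h5.trans hκ
  have h7 := h2.trans hA₀
  have h8 := h1.trans hA
  gcongr

variable [DecidableEq X]

/-- Inversion of small perturbations of the identity, with tame estimates. -/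
theorem sobNorm_inv_one_add_le {s s₀ κ : ℝ} (h : (d : ℝ) / 2 < s₀) (hs : s₀ ≤ s)
    (hκ : 2 ^ s * ‖bracketSeq h‖ ≤ κ) {P : Matrix X X ℂ} (hP : 4 * κ * sobNorm s₀ P ≤ 1) :
    IsUnit (1 + P) ∧ sobNorm s₀ (1 + P)⁻¹ ≤ 2 ∧ sobNorm s (1 + P)⁻¹ ≤ 2 + 4 * κ * sobNorm s P := by
  have hs₀ : 0 ≤ s₀ := by have : (0:ℝ) ≤ d := Nat.cast_nonneg d; linarith
  have hκ₀ : 2 ^ s₀ * ‖bracketSeq h‖ ≤ κ := by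
    refine le_trans ?_ hκ
    gcongr
    norm_num
  have hκ0 : 0 ≤ κ := le_trans (by positivity) hκ
  have hunit : IsUnit (1 + P) := by
    rw [Matrix.isUnit_iff_isUnit_det, isUnit_iff_ne_zero]
    intro hdet
    -- A kernel vector repeated in every column gives U = −P U, and the product estimate then forces
    -- ‖U‖ ≤ ‖U‖/2 in the s₀ norm.
    obtain ⟨v, hv, hPv⟩ := Matrix.exists_mulVec_eq_zero_iff.mpr hdet
    apply hv
    set U : Matrix X X ℂ := fun x _ => v x with hU
    have hPU : (1 + P) * U = 0 := by
      ext x y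
      exact congrFun hPv x
    have hU' : sobNorm s₀ U = sobNorm s₀ (P * U) := by
      rw [← sobNorm_neg]
      congr 1
      rw [add_mul, one_mul] at hPU
      rw [← eq_neg_of_add_eq_zero_right hPU]
    have h1 := sobNorm_mul_le_of_le h hs₀ hκ₀ (A := P) (B := U) le_rfl le_rfl le_rfl le_rfl
    rw [← hU'] at h1
    have h2 := sobNorm_nonneg s₀ U
    have h3 : sobNorm s₀ U = 0 := by nlinarith
    have h4 := eq_zero_of_sobNorm_eq_zero h3
    ext x
    exact congrFun (congrFun h4 x) x
  -- Both bounds follow from this identity by absorption. The s₀ bound comes first and then enters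
  -- the product estimate for the s bound.
  have hF : (1 + P)⁻¹ = 1 - P * (1 + P)⁻¹ := by
    have := Matrix.mul_nonsing_inv (1 + P) ((Matrix.isUnit_iff_isUnit_det _).mp hunit)
    rw [add_mul, one_mul] at this
    exact eq_sub_of_add_eq this
  set F := (1 + P)⁻¹ with hFdef
  have hF₀ : sobNorm s₀ F ≤ 2 := by
    have h1 := sobNorm_mul_le_of_le h hs₀ hκ₀ (A := P) (B := F) le_rfl le_rfl le_rfl le_rfl
    have h2 := sobNorm_sub_le s₀ 1 (P * F)
    rw [← hF] at h2
    have h3 := sobNorm_one_le (X := X) s₀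
    have h4 := sobNorm_nonneg s₀ F
    nlinarith
  refine ⟨hunit, hF₀, ?_⟩
  have h1 := sobNorm_mul_le_of_le h (hs₀.trans hs) hκ (A := P) (B := F) le_rfl le_rfl le_rfl hF₀
  have h2 := sobNorm_sub_le s 1 (P * F)
  rw [← hF] at h2
  have h3 := sobNorm_one_le (X := X) s
  have h4 := sobNorm_nonneg s F
  nlinarith

/-- The projection to the sites in `B`. -/
noncomputable def siteProj (B : X → Prop) [DecidablePred B] : Matrix X X ℂ :=
  Matrix.diagonal fun x => if B x then 1 else 0

theorem siteProj_mul_apply (B : X → Prop) [DecidablePred B] (M : Matrix X X ℂ) (x y : X) :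
    (siteProj B * M) x y = if B x then M x y else 0 := by
  rw [siteProj, Matrix.diagonal_mul]
  split_ifs <;> simp

theorem mul_siteProj_apply (B : X → Prop) [DecidablePred B] (M : Matrix X X ℂ) (x y : X) :
    (M * siteProj B) x y = if B y then M x y else 0 := by
  rw [siteProj, Matrix.mul_diagonal]
  split_ifs <;> simp

theorem siteProj_mul_siteProj (B : X → Prop) [DecidablePred B] :
    siteProj B * siteProj B = siteProj B := by
  ext x y
  rw [siteProj_mul_apply]
  by_cases hB : B x
  · rw [if_pos hB]
  · rw [if_neg hB, siteProj, Matrix.diagonal_apply]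
    split_ifs <;> simp_all

/-- For equal labels, the part of the row sum of `G * M` lost by cutting `G` meets only off-diagonal
blocks of `M`; this is the second correction. For distinct labels, every surviving term uses an
off-diagonal block of `M`; this is the first. -/
theorem blockCut_mul {ι : Type*} [DecidableEq ι] (B : X → Prop) [DecidablePred B] (c : X → ι)
    (G M : Matrix X X ℂ) (hGM : siteProj B * (G * M) = siteProj B) :
    blockCut B c G * M =
      siteProj B + (blockCut B c G * offBlock c M - blockCut B c (G * offBlock c M)) := by
  rw [add_sub, eq_sub_iff_add_eq, ← sub_eq_iff_eq_add, add_sub_right_comm, ← Matrix.mul_sub]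
  ext x y
  have hGM' := congrFun (congrFun hGM x) y
  rw [siteProj_mul_apply] at hGM'
  rw [Matrix.add_apply, Matrix.mul_apply]
  by_cases hx : B x
  · by_cases hc : c x = c y
    · rw [← hGM', if_pos hx]
      simp only [blockCut, offBlock, hx, hc, true_and, if_true, Matrix.mul_apply]
      rw [← Finset.sum_add_distrib]
      refine Finset.sum_congr rfl fun z _ => ?_
      rw [Matrix.sub_apply]
      by_cases hz : c z = c y
      · simp [hz, offBlock]
      · simp [hz, Ne.symm hz, offBlock]
    · have hxy : x ≠ y := fun e => hc (by rw [e])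
      rw [siteProj, Matrix.diagonal_apply_ne _ hxy]
      simp only [blockCut, hx, hc, and_false, if_false, add_zero, true_and]
      refine Finset.sum_eq_zero fun z _ => ?_
      by_cases hz : c x = c z
      · have : c z ≠ c y := fun e => hc (hz.trans e)
        simp [offBlock, this]
      · simp [hz]
  · rw [← hGM', if_neg hx]
    simp [blockCut, hx]

/-- Controls the matrix M = A(1 + P)⁻¹R, whose off-diagonal blocks carry the interaction between
clusters of bad sites. -/
theorem sobNorm_mul_inv_mul_siteProj_le {s s₀ k σ : ℝ}
    (h : (d : ℝ) / 2 < s₀) (hs : s₀ ≤ s) (hk : 2 ^ s * ‖bracketSeq h‖ ≤ k) (hk1 : 1 ≤ k)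
    (hσ : 1 ≤ σ) {A P : Matrix X X ℂ} (B : X → Prop) [DecidablePred B]
    (hA : sobNorm s A ≤ k) (hP : sobNorm s P ≤ k * σ) (hP₀ : 4 * k * sobNorm s₀ P ≤ 1) :
    sobNorm s (A * (1 + P)⁻¹ * siteProj B) ≤ 8 * k ^ 4 * σ := by
  have hs0 : 0 ≤ s := by have : (0:ℝ) ≤ d := Nat.cast_nonneg d; linarith
  obtain ⟨-, hF₀, hF⟩ := sobNorm_inv_one_add_le h hs hk hP₀
  have eF := two_add_le_of_le hk1 hσ hP hF
  calc _ ≤ sobNorm s (A * (1 + P)⁻¹) := sobNorm_mono fun x y => by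
        rw [mul_siteProj_apply]; split_ifs <;> simp
    _ ≤ k * (k * 2 + k * (6 * k ^ 2 * σ)) :=
        sobNorm_mul_le_of_le h hs0 hk hA ((sobNorm_le_of_exponent_le hs A).trans hA) eF hF₀
    _ = 2 * (k ^ 2 * 1) + 6 * (k ^ 4 * σ) := by ring
    _ ≤ 2 * (k ^ 4 * σ) + 6 * (k ^ 4 * σ) := by gcongr; norm_num
    _ = _ := by ring

/-- The deterministic coupling estimate, in terms of abstract bounds. -/
theorem sobNorm_inverse_le {ι : Type*} [DecidableEq ι] {s s₀ k σ σ₀ y y₀ d₀ : ℝ}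
    (h : (d : ℝ) / 2 < s₀) (hs : s₀ ≤ s) (hk : 2 ^ s * ‖bracketSeq h‖ ≤ k) (hk1 : 1 ≤ k)
    (hσ : 1 ≤ σ) (hσ₀ : 1 ≤ σ₀) (hy : 1 ≤ y) (hy₀ : 1 ≤ y₀) (hd₀ : 0 ≤ d₀)
    {A G S P : Matrix X X ℂ} (B : X → Prop) [DecidablePred B] (c : X → ι)
    (hGA : G * A = 1) (hSA : S * A + siteProj B = 1 + P) (hBP : siteProj B * P = 0)
    (hA : sobNorm s A ≤ k) (hS : sobNorm s S ≤ k * σ) (hS₀ : sobNorm s₀ S ≤ k * σ₀)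
    (hP : sobNorm s P ≤ k * σ) (hP₀ : 4 * k * sobNorm s₀ P ≤ 1)
    (hY : sobNorm s (blockCut B c G) ≤ k * y) (hY₀ : sobNorm s₀ (blockCut B c G) ≤ k * y₀)
    (hD₀ : sobNorm s₀ (offBlock c (A * (1 + P)⁻¹ * siteProj B)) ≤ d₀)
    (hV : sobNorm s (blockCut B c (G * offBlock c (A * (1 + P)⁻¹ * siteProj B))) ≤ k * y * d₀)
    (hV₀ : sobNorm s₀ (blockCut B c (G * offBlock c (A * (1 + P)⁻¹ * siteProj B))) ≤
      k * y₀ * d₀)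
    (hsmall : 12 * k ^ 3 * y₀ * d₀ ≤ 1) :
    sobNorm s G ≤ 1210 * k ^ 15 * (y + y₀ ^ 2 * σ) * σ₀ := by
  have hs₀ : 0 ≤ s₀ := by have : (0:ℝ) ≤ d := Nat.cast_nonneg d; linarith
  have hs0 : 0 ≤ s := hs₀.trans hs
  have hk₀ : 2 ^ s₀ * ‖bracketSeq h‖ ≤ k := by
    refine le_trans ?_ hk
    gcongr
    norm_num
  have hA₀ : sobNorm s₀ A ≤ k := (sobNorm_le_of_exponent_le hs A).trans hA
  obtain ⟨hunit, hF₀, hF⟩ := sobNorm_inv_one_add_le h hs hk hP₀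
  set F := (1 + P)⁻¹ with hFdef
  have hAG : A * G = 1 := mul_eq_one_comm.mp hGA
  have hdet := (Matrix.isUnit_iff_isUnit_det _).mp hunit
  have hF1 : F * (1 + P) = 1 := Matrix.nonsing_inv_mul _ hdet
  have hF2 : (1 + P) * F = 1 := Matrix.mul_nonsing_inv _ hdet
  set R := siteProj B with hR
  have hRF : R * F = R := by
    calc R * F = (R + R * P) * F := by rw [hBP, add_zero]
      _ = R * ((1 + P) * F) := by rw [← Matrix.mul_assoc, Matrix.mul_add, Matrix.mul_one]
      _ = R := by rw [hF2, Matrix.mul_one]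
  -- The approximate inverse leaves only the rows of `G` in `B` to be estimated, that is, `R * G`.
  have hG : G = F * S + F * (R * G) := by
    calc G = F * (S * A + R) * G := by rw [hSA, hF1, Matrix.one_mul]
      _ = F * (S * (A * G)) + F * (R * G) := by
        simp only [Matrix.mul_add, Matrix.add_mul, Matrix.mul_assoc]
      _ = _ := by rw [hAG, Matrix.mul_one]
  set M := A * F * R with hM
  have hRGM : R * (G * M) = R := by
    calc R * (G * M) = R * ((G * A) * F * R) := by rw [hM]; simp only [Matrix.mul_assoc]
      _ = R * F * R := by rw [hGA, Matrix.one_mul, Matrix.mul_assoc]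
      _ = R := by rw [hRF, siteProj_mul_siteProj]
  -- `Q` no longer contains `G`. Since M(RG) = Q, an approximate left inverse Y of M, with Y M = R +
  -- Z, recovers R G from Y Q up to the factor 1 + Z.
  set Q := 1 - A * (F * S) with hQ
  have hMG : M * (R * G) = Q := by
    calc M * (R * G) = A * (F * ((R * R) * G)) := by rw [hM]; simp only [Matrix.mul_assoc]
      _ = A * (F * (R * G)) := by rw [siteProj_mul_siteProj]
      _ = A * (G - F * S) := by rw [← eq_sub_of_add_eq' hG.symm]
      _ = Q := by rw [Matrix.mul_sub, hAG]
  set D := offBlock c M with hDdef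
  set Y := blockCut B c G with hYdef
  set V := blockCut B c (G * D) with hVdef
  set Z := Y * D - V with hZ
  have hYM : Y * M = R + Z := blockCut_mul B c G M hRGM
  have hYQ : Y * Q = (1 + Z) * (R * G) := by
    calc Y * Q = (Y * M) * (R * G) := by rw [← hMG]; exact (Matrix.mul_assoc Y M (R * G)).symm
      _ = (R * R) * G + Z * (R * G) := by rw [hYM, Matrix.add_mul, Matrix.mul_assoc R R G]
      _ = _ := by rw [siteProj_mul_siteProj, Matrix.add_mul, Matrix.one_mul]
  -- estimates
  have eF := two_add_le_of_le hk1 hσ hP hF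
  have eFS₀ : sobNorm s₀ (F * S) ≤ 4 * k ^ 2 * σ₀ :=
    (sobNorm_mul_le_of_le h hs₀ hk₀ hF₀ hF₀ hS₀ hS₀).trans (by apply le_of_eq; ring)
  have eFS : sobNorm s (F * S) ≤ 8 * k ^ 4 * σ * σ₀ := by
    calc _ ≤ k * (6 * k ^ 2 * σ * (k * σ₀) + 2 * (k * σ)) :=
          sobNorm_mul_le_of_le h hs0 hk eF hF₀ hS hS₀
      _ = 6 * (k ^ 4 * σ * σ₀) + 2 * (k ^ 2 * σ * 1) := by ring
      _ ≤ 6 * (k ^ 4 * σ * σ₀) + 2 * (k ^ 4 * σ * σ₀) := by gcongr; norm_num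
      _ = _ := by ring
  have eM : sobNorm s M ≤ 8 * k ^ 4 * σ := sobNorm_mul_inv_mul_siteProj_le h hs hk hk1 hσ B hA hP hP₀
  have eD : sobNorm s D ≤ 8 * k ^ 4 * σ := (sobNorm_mono (norm_offBlock_le c M)).trans eM
  have eQ₀ : sobNorm s₀ Q ≤ 9 * k ^ 4 * σ₀ := by
    calc sobNorm s₀ Q ≤ 1 + k * (k * (4 * k ^ 2 * σ₀) + k * (4 * k ^ 2 * σ₀)) :=
          (sobNorm_sub_le _ _ _).trans (add_le_add (sobNorm_one_le s₀)
            (sobNorm_mul_le_of_le h hs₀ hk₀ hA₀ hA₀ eFS₀ eFS₀))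
      _ = 1 * 1 + 8 * (k ^ 4 * σ₀) := by ring
      _ ≤ k ^ 4 * σ₀ + 8 * (k ^ 4 * σ₀) := by gcongr; exact one_le_pow₀ hk1
      _ = _ := by ring
  have eQ : sobNorm s Q ≤ 13 * k ^ 6 * σ * σ₀ := by
    calc sobNorm s Q ≤ 1 + k * (k * (4 * k ^ 2 * σ₀) + k * (8 * k ^ 4 * σ * σ₀)) :=
          (sobNorm_sub_le _ _ _).trans (add_le_add (sobNorm_one_le s)
            (sobNorm_mul_le_of_le h hs0 hk hA hA₀ eFS eFS₀))
      _ = 1 * 1 * 1 + 4 * (k ^ 4 * 1 * σ₀) + 8 * (k ^ 6 * σ * σ₀) := by ring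
      _ ≤ k ^ 6 * σ * σ₀ + 4 * (k ^ 6 * σ * σ₀) + 8 * (k ^ 6 * σ * σ₀) := by
          gcongr
          · exact one_le_pow₀ hk1
          · norm_num
      _ = _ := by ring
  have eZ : sobNorm s Z ≤ 2 * k ^ 2 * y * d₀ + 8 * k ^ 6 * y₀ * σ := by
    calc sobNorm s Z ≤ k * (k * y * d₀ + k * y₀ * (8 * k ^ 4 * σ)) + k * y * d₀ :=
          (sobNorm_sub_le _ _ _).trans (add_le_add
            (sobNorm_mul_le_of_le h hs0 hk hY hY₀ eD hD₀) hV)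
      _ = k ^ 2 * y * d₀ + 8 * k ^ 6 * y₀ * σ + k ^ 1 * y * d₀ := by ring
      _ ≤ k ^ 2 * y * d₀ + 8 * k ^ 6 * y₀ * σ + k ^ 2 * y * d₀ := by gcongr; norm_num
      _ = _ := by ring
  have eZ₀ : 4 * k * sobNorm s₀ Z ≤ 1 := by
    refine le_trans ?_ hsmall
    calc 4 * k * sobNorm s₀ Z ≤
          4 * k * (k * (k * y₀ * d₀ + k * y₀ * d₀) + k * y₀ * d₀) := by
          gcongr
          exact (sobNorm_sub_le _ _ _).trans (add_le_add
            (sobNorm_mul_le_of_le h hs₀ hk₀ hY₀ hY₀ hD₀ hD₀) hV₀)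
      _ = 8 * (k ^ 3 * y₀ * d₀) + 4 * (k ^ 2 * y₀ * d₀) := by ring
      _ ≤ 8 * (k ^ 3 * y₀ * d₀) + 4 * (k ^ 3 * y₀ * d₀) := by gcongr; norm_num
      _ = _ := by ring
  obtain ⟨hunitZ, hE₀, hE⟩ := sobNorm_inv_one_add_le h hs hk eZ₀
  set E := (1 + Z)⁻¹ with hEdef
  have hRG : R * G = E * Y * Q := by
    rw [Matrix.mul_assoc, hYQ, ← Matrix.mul_assoc,
      Matrix.nonsing_inv_mul _ ((Matrix.isUnit_iff_isUnit_det _).mp hunitZ), Matrix.one_mul]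
  have eEY₀ : sobNorm s₀ (E * Y) ≤ 4 * k ^ 2 * y₀ :=
    (sobNorm_mul_le_of_le h hs₀ hk₀ hE₀ hE₀ hY₀ hY₀).trans (by apply le_of_eq; ring)
  have eEY : sobNorm s (E * Y) ≤ 37 * k ^ 9 * (y + y₀ ^ 2 * σ) := by
    have e1 : sobNorm s E ≤ 2 + 8 * k ^ 3 * y * d₀ + 32 * k ^ 7 * y₀ * σ := by
      calc sobNorm s E ≤ 2 + 4 * k * (2 * k ^ 2 * y * d₀ + 8 * k ^ 6 * y₀ * σ) :=
            hE.trans (by gcongr)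
        _ = _ := by ring
    calc sobNorm s (E * Y) ≤
          k * ((2 + 8 * k ^ 3 * y * d₀ + 32 * k ^ 7 * y₀ * σ) * (k * y₀) + 2 * (k * y)) :=
          sobNorm_mul_le_of_le h hs0 hk e1 hE₀ hY hY₀
      _ = 2 * (k ^ 2 * (y₀ * 1)) + k ^ 2 * y * (8 * k ^ 3 * y₀ * d₀) + 32 * (k ^ 9 * (y₀ ^ 2 * σ))
          + 2 * (k ^ 2 * y) := by ring
      _ ≤ 2 * (k ^ 9 * (y₀ ^ 2 * σ)) + k ^ 9 * y * 1 + 32 * (k ^ 9 * (y₀ ^ 2 * σ))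
          + 2 * (k ^ 9 * y) := by
          -- Smallness of `d₀` cancels the factor `y₀` that multiplies `y`.
          have : 8 * k ^ 3 * y₀ * d₀ ≤ 1 := le_trans (by gcongr; norm_num) hsmall
          gcongr
          · norm_num
          · exact le_self_pow₀ hy₀ (by norm_num)
          · norm_num
          · norm_num
      _ = 3 * k ^ 9 * y + 34 * k ^ 9 * (y₀ ^ 2 * σ) := by ring
      _ ≤ 37 * k ^ 9 * y + 37 * k ^ 9 * (y₀ ^ 2 * σ) := by gcongr <;> norm_num
      _ = _ := by ring
  set w := y + y₀ ^ 2 * σ with hw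
  have hw1 : y₀ * σ ≤ w := by
    have : y₀ * σ ≤ y₀ ^ 2 * σ := by gcongr; exact le_self_pow₀ hy₀ (by norm_num)
    rw [hw]; linarith
  have eR₀ : sobNorm s₀ (R * G) ≤ 72 * k ^ 7 * y₀ * σ₀ := by
    rw [hRG]
    exact (sobNorm_mul_le_of_le h hs₀ hk₀ eEY₀ eEY₀ eQ₀ eQ₀).trans (by apply le_of_eq; ring)
  have eR : sobNorm s (R * G) ≤ 385 * k ^ 14 * w * σ₀ := by
    rw [hRG]
    calc _ ≤ k * (37 * k ^ 9 * w * (9 * k ^ 4 * σ₀) + 4 * k ^ 2 * y₀ * (13 * k ^ 6 * σ * σ₀)) :=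
          sobNorm_mul_le_of_le h hs0 hk eEY eEY₀ eQ eQ₀
      _ = 333 * (k ^ 14 * w * σ₀) + 52 * (k ^ 9 * (y₀ * σ) * σ₀) := by ring
      _ ≤ 333 * (k ^ 14 * w * σ₀) + 52 * (k ^ 14 * w * σ₀) := by gcongr; norm_num
      _ = _ := by ring
  have eFR : sobNorm s (F * (R * G)) ≤ 1202 * k ^ 15 * w * σ₀ := by
    calc _ ≤ k * (6 * k ^ 2 * σ * (72 * k ^ 7 * y₀ * σ₀) + 2 * (385 * k ^ 14 * w * σ₀)) :=
          sobNorm_mul_le_of_le h hs0 hk eF hF₀ eR eR₀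
      _ = 432 * (k ^ 10 * (y₀ * σ) * σ₀) + 770 * (k ^ 15 * w * σ₀) := by ring
      _ ≤ 432 * (k ^ 15 * w * σ₀) + 770 * (k ^ 15 * w * σ₀) := by gcongr; norm_num
      _ = _ := by ring
  rw [hG]
  calc _ ≤ 8 * k ^ 4 * σ * σ₀ + 1202 * k ^ 15 * w * σ₀ :=
        (sobNorm_add_le _ _ _).trans (add_le_add eFS eFR)
    _ = 8 * (k ^ 4 * (1 * σ) * σ₀) + 1202 * k ^ 15 * w * σ₀ := by ring
    _ ≤ 8 * (k ^ 15 * w * σ₀) + 1202 * k ^ 15 * w * σ₀ := by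
        have : 1 * σ ≤ w := le_trans (by gcongr) hw1
        gcongr
        norm_num
    _ = _ := by ring

end Coupling

/-! ### Clusters of bad sites and subcubes. -/

section Geometry

variable {d : ℕ}

/-- Sites near a finite set of centres can be labelled so that sites with different labels are far
apart, and sites with the same label are not too far apart. -/
theorem exists_label (K : Finset (ZLat d)) {ρ : ℝ} (hρ : 0 ≤ ρ) :
    ∃ (ι : Type) (c : ZLat d → ι), ∀ y, (∃ k ∈ K, ‖y - k‖ ≤ ρ) → ∀ x,
      (c x ≠ c y → ρ ≤ ‖x - y‖) ∧ (c x = c y → ‖x - y‖ ≤ 6 * (K.card + 1) * ρ) := by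
  classical
  let Γ : SimpleGraph K := SimpleGraph.fromRel fun a b => ‖(a : ZLat d) - b‖ ≤ 6 * ρ
  -- Two centres within 3ρ of the same site are within 6ρ of each other, so the chosen centre does
  -- not affect the label. A site within ρ of `y`, where `y` is within ρ of a centre, is within 2ρ
  -- of that centre and so shares the label of `y`. Sites far from `K` all get `none`, which never
  -- equals the label of such a `y`.
  let c : ZLat d → Option Γ.ConnectedComponent := fun x =>
    if h : ∃ k : K, ‖x - k‖ ≤ 3 * ρ then some (Γ.connectedComponentMk h.choose) else none
  have hadj : ∀ a b : K, ‖(a : ZLat d) - b‖ ≤ 6 * ρ →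
      Γ.connectedComponentMk a = Γ.connectedComponentMk b := by
    intro a b hab
    by_cases h : a = b
    · rw [h]
    · refine SimpleGraph.ConnectedComponent.sound (SimpleGraph.Adj.reachable ?_)
      exact (SimpleGraph.fromRel_adj _ _ _).mpr ⟨h, Or.inl hab⟩
  have hc : ∀ (x : ZLat d) (k : K), ‖x - k‖ ≤ 3 * ρ → c x = some (Γ.connectedComponentMk k) := by
    intro x k hk
    have h : ∃ k : K, ‖x - k‖ ≤ 3 * ρ := ⟨k, hk⟩
    have e : c x = some (Γ.connectedComponentMk h.choose) := dif_pos h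
    rw [e]
    congr 1
    apply hadj
    have h1 := h.choose_spec
    have h2 : (h.choose : ZLat d) - k = (x - k) - (x - h.choose) := by abel
    rw [h2]
    exact (norm_sub_le _ _).trans (by linarith)
  have hwalk : ∀ (a b : K) (p : Γ.Walk a b), ‖(a : ZLat d) - b‖ ≤ p.length * (6 * ρ) := by
    intro a b p
    induction p with
    | nil => simp
    | @cons u v w huv q ih =>
      have h1 : ‖(u : ZLat d) - v‖ ≤ 6 * ρ := by
        rcases ((SimpleGraph.fromRel_adj _ _ _).mp huv).2 with h | h
        · exact h
        · rwa [norm_sub_rev] at h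
      have h2 : (u : ZLat d) - w = (u - v) + (v - w) := by abel
      rw [h2, SimpleGraph.Walk.length_cons]
      push_cast
      exact (norm_add_le _ _).trans (by linarith)
  refine ⟨_, c, fun y ⟨k, hkK, hk⟩ x => ⟨fun hne => ?_, fun heq => ?_⟩⟩
  · by_contra! hlt
    refine hne ((hc x ⟨k, hkK⟩ ?_).trans (hc y ⟨k, hkK⟩ ?_).symm)
    · have : x - k = (x - y) + (y - k) := by abel
      change ‖x - k‖ ≤ _
      rw [this]
      exact (norm_add_le _ _).trans (by linarith)
    · change ‖y - k‖ ≤ _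
      linarith
  · rw [hc y ⟨k, hkK⟩ (by change ‖y - k‖ ≤ _; linarith)] at heq
    have hx : ∃ k : K, ‖x - k‖ ≤ 3 * ρ := by
      by_contra h
      have e : c x = none := dif_neg h
      rw [e] at heq
      exact absurd heq (by simp)
    obtain ⟨j, hj⟩ := hx
    rw [hc x j hj, Option.some.injEq] at heq
    -- A path repeats no centre, so it has fewer than `K.card` steps of length at most 6ρ; the two
    -- ends add at most 3ρ + ρ.
    obtain ⟨p, hp⟩ := (SimpleGraph.ConnectedComponent.exact heq).exists_isPath
    have h1 := hwalk _ _ p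
    have h2 : (p.length : ℝ) ≤ K.card := by
      have := hp.length_lt
      rw [Fintype.card_coe] at this
      exact_mod_cast this.le
    have h3 : (p.length : ℝ) * (6 * ρ) ≤ K.card * (6 * ρ) := by gcongr
    have h4 : x - y = (x - j) + ((j : ZLat d) - k) - (y - k) := by abel
    rw [h4]
    have h5 := norm_sub_le ((x - j) + ((j : ZLat d) - k)) (y - k)
    have h6 := norm_add_le (x - j) ((j : ZLat d) - k)
    change ‖(j : ZLat d) - k‖ ≤ _ at h1
    linarith

theorem mem_cube_iff {L : ℕ} {n k : ZLat d} : k ∈ cube L n ↔ ∀ i, |k i - n i| ≤ L := by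
  change ‖k - n‖ ≤ (L : ℝ) ↔ _
  rw [pi_norm_le_iff_of_nonneg (Nat.cast_nonneg _)]
  refine forall_congr' fun i => ?_
  rw [Pi.sub_apply, Int.norm_eq_abs]
  exact_mod_cast Iff.rfl

/-- Every site `x` of a cube of radius `L` lies in a subcube of radius `l` which contains all sites
of the big cube at distance at most `l` from `x`. -/
theorem exists_subcube {l L : ℕ} (hl : l ≤ L) {n x : ZLat d} (hx : x ∈ cube L n) :
    ∃ k ∈ cube L n, cube l k ⊆ cube L n ∧ x ∈ cube l k ∧
      ∀ y ∈ cube L n, ‖x - y‖ ≤ l → y ∈ cube l k := by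
  rw [mem_cube_iff] at hx
  have hxy : ∀ y : ZLat d, ‖x - y‖ ≤ l → ∀ i, |x i - y i| ≤ l := by
    intro y hy i
    have := (norm_le_pi_norm (x - y) i).trans hy
    rw [Pi.sub_apply, Int.norm_eq_abs] at this
    exact_mod_cast this
  have hlL : (l : ℤ) ≤ L := by exact_mod_cast hl
  -- The centre is x with each coordinate clamped to [n_i − (L−l), n_i + (L−l)]. Near a face the
  -- subcube is pushed inside, which loses no site of the big cube within l of x.
  have key : ∀ i, |max (n i - (L - l)) (min (x i) (n i + (L - l))) - n i| ≤ (L : ℤ) - l ∧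
      |x i - max (n i - (L - l)) (min (x i) (n i + (L - l)))| ≤ (l : ℤ) ∧
      ∀ y : ℤ, |y - n i| ≤ L → |x i - y| ≤ l →
        |y - max (n i - (L - l)) (min (x i) (n i + (L - l)))| ≤ (l : ℤ) := by
    intro i
    have := hx i
    simp only [abs_le] at *
    refine ⟨⟨?_, ?_⟩, ⟨?_, ?_⟩, fun y hy hy' => ⟨?_, ?_⟩⟩ <;> omega
  refine ⟨fun i => max (n i - (L - l)) (min (x i) (n i + (L - l))), ?_, ?_, ?_, ?_⟩
  · rw [mem_cube_iff]
    intro i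
    exact (key i).1.trans (by omega)
  · intro y hy
    rw [mem_cube_iff] at hy ⊢
    intro i
    have h1 := (key i).1
    have h2 := hy i
    rw [abs_le] at *
    constructor <;> omega
  · rw [mem_cube_iff]
    exact fun i => (key i).2.1
  · intro y hy hxy'
    rw [mem_cube_iff] at hy ⊢
    exact fun i => (key i).2.2 _ (hy i) (hxy y hxy' i)

end Geometry

/-! ### Resolvent bounds from the distance to the spectrum. -/

section Hermitian

variable {n : Type*} [Fintype n] [DecidableEq n]

/-- In an orthonormal eigenbasis, H − E multiplies each coordinate by a number of modulus at least
η. -/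
theorem sum_norm_sq_le_of_spectrum {H : Matrix n n ℂ} (hH : H.IsHermitian) {E η : ℝ}
    (hη : 0 ≤ η) (hspec : ∀ a ∈ spectrum ℂ H, η ≤ ‖a - E‖) (v : n → ℂ) :
    η ^ 2 * ∑ x, ‖v x‖ ^ 2 ≤ ∑ x, ‖((H - (E : ℂ) • 1).mulVec v) x‖ ^ 2 := by
  set b := hH.eigenvectorBasis
  set u : EuclideanSpace ℂ n := WithLp.toLp 2 v with hu
  set w : EuclideanSpace ℂ n := WithLp.toLp 2 ((H - (E : ℂ) • 1).mulVec v) with hw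
  have e1 : ∑ x, ‖v x‖ ^ 2 = ‖u‖ ^ 2 := (EuclideanSpace.norm_sq_eq u).symm
  have e2 : ∑ x, ‖((H - (E : ℂ) • 1).mulVec v) x‖ ^ 2 = ‖w‖ ^ 2 :=
    (EuclideanSpace.norm_sq_eq w).symm
  rw [e1, e2, ← b.sum_sq_norm_inner_right, ← b.sum_sq_norm_inner_right, Finset.mul_sum]
  refine Finset.sum_le_sum fun i _ => ?_
  have hi : inner ℂ (b i) w = ((hH.eigenvalues i : ℂ) - E) * inner ℂ (b i) u := by
    rw [hw, Matrix.sub_mulVec, Matrix.smul_mulVec, Matrix.one_mulVec, WithLp.toLp_sub,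
      inner_sub_right, WithLp.toLp_smul, inner_smul_right, sub_mul]
    congr 1
    have h1 : inner ℂ (b i) (WithLp.toLp 2 (H.mulVec v)) =
        inner ℂ (WithLp.toLp 2 (H.mulVec (b i))) u := by
      simp only [EuclideanSpace.inner_eq_star_dotProduct, hu]
      rw [Matrix.star_mulVec, hH.eq, dotProduct_comm, dotProduct_comm v,
        ← Matrix.dotProduct_mulVec]
    rw [h1, hH.mulVec_eigenvectorBasis i]
    have h2 : WithLp.toLp 2 (hH.eigenvalues i • (⇑(hH.eigenvectorBasis i) : n → ℂ)) =
        ((hH.eigenvalues i : ℝ) : ℂ) • b i := by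
      ext x; simp [b]
    rw [h2, inner_smul_left, Complex.conj_ofReal]
  rw [hi, norm_mul, mul_pow]
  gcongr
  refine hspec _ ?_
  rw [hH.spectrum_eq_image_range]
  exact ⟨_, ⟨i, rfl⟩, rfl⟩

theorem isUnit_of_spectrum {H : Matrix n n ℂ} {E η : ℝ} (hη : 0 < η)
    (hspec : ∀ a ∈ spectrum ℂ H, η ≤ ‖a - E‖) : IsUnit (H - (E : ℂ) • 1) := by
  have : (E : ℂ) ∉ spectrum ℂ H := fun h => by
    have := hspec _ h
    rw [sub_self, norm_zero] at this
    linarith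
  rw [spectrum.notMem_iff, Algebra.algebraMap_eq_smul_one] at this
  rw [← neg_sub]
  exact this.neg

/-- The resolvent has ℓ² norm at most 1/η, so one column of `B` controls the entry. It is used with
`B = 1` for the Green's function and with the off-diagonal blocks of M. -/
theorem norm_inv_mul_apply_le {H : Matrix n n ℂ} (hH : H.IsHermitian) {E η : ℝ}
    (hη : 0 < η) (hspec : ∀ a ∈ spectrum ℂ H, η ≤ ‖a - E‖) (B : Matrix n n ℂ) (x y : n) {c : ℝ}
    (hc : 0 ≤ c) (hB : ∑ z, ‖B z y‖ ^ 2 ≤ c ^ 2) :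
    ‖((H - (E : ℂ) • 1)⁻¹ * B) x y‖ ≤ η⁻¹ * c := by
  have hu := (Matrix.isUnit_iff_isUnit_det _).mp (isUnit_of_spectrum hη hspec)
  set A := H - (E : ℂ) • (1 : Matrix n n ℂ) with hA
  have h1 := sum_norm_sq_le_of_spectrum hH hη.le hspec fun z => (A⁻¹ * B) z y
  have h2 : (A.mulVec fun z => (A⁻¹ * B) z y) = fun z => B z y := by
    have : A * (A⁻¹ * B) = B := by
      rw [← Matrix.mul_assoc, Matrix.mul_nonsing_inv _ hu, Matrix.one_mul]
    ext z
    exact congrFun (congrFun this z) y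
  rw [← hA, h2] at h1
  have h3 : ‖(A⁻¹ * B) x y‖ ^ 2 ≤ ∑ z, ‖(A⁻¹ * B) z y‖ ^ 2 :=
    Finset.single_le_sum (f := fun z => ‖(A⁻¹ * B) z y‖ ^ 2) (fun _ _ => sq_nonneg _)
      (Finset.mem_univ x)
  rw [inv_mul_eq_div, le_div_iff₀ hη]
  refine abs_le_of_sq_le_sq' ?_ hc |>.2
  rw [mul_pow]
  have h4 : ‖(A⁻¹ * B) x y‖ ^ 2 * η ^ 2 ≤ (∑ z, ‖(A⁻¹ * B) z y‖ ^ 2) * η ^ 2 := by gcongr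
  linarith

end Hermitian

/-! ### The hopping term: all its bounds in terms of ‖T‖_{r₁}. -/

section Hopping

variable {d : ℕ}

theorem hopping_translate (r : ℝ) (x y : ZLat d) : hopping d r x y = hopping d r (x - y) 0 := by
  simp [hopping, sub_eq_zero]

theorem norm_hopping_le_bracket (r : ℝ) (k : ZLat d) :
    ‖hopping d r k 0‖ ≤ bracket k ^ (-r) := by
  by_cases hk : k = 0
  · subst hk
    simp only [hopping, if_true, norm_zero]
    exact Real.rpow_nonneg (bracket_pos _).le _
  · refine (norm_hopping_zero_le d r k).trans (le_of_eq ?_)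
    rw [bracket, max_eq_right (one_le_norm_of_ne_zero hk)]

theorem memlp_hopping {r r₁ : ℝ} (h : r₁ < r - (d : ℝ) / 2) :
    Memℓp (fun k : ZLat d => hopping d r k 0 * ((bracket k ^ r₁ : ℝ) : ℂ)) 2 := by
  refine memℓp_gen (Summable.of_nonneg_of_le (fun k => by positivity) (fun k => ?_)
    (summable_bracket_rpow (d := d) (r := 2 * (r - r₁)) (by linarith)))
  have : (2 : ℝ≥0∞).toReal = ((2 : ℕ) : ℝ) := by norm_num
  have hb := Real.rpow_nonneg (bracket_pos k).le r₁
  rw [this, Real.rpow_natCast, norm_mul, Complex.norm_real, Real.norm_of_nonneg hb]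
  calc (‖hopping d r k 0‖ * bracket k ^ r₁) ^ 2 ≤ (bracket k ^ (-r) * bracket k ^ r₁) ^ 2 := by
        gcongr
        exact norm_hopping_le_bracket r k
    _ = _ := by
        rw [← Real.rpow_add (bracket_pos k), bracket_rpow_sq]
        congr 1; ring

/-- The sequence `k ↦ T(k, 0) ⟨k⟩^{r₁}`. -/
noncomputable def hoppingSeq {r r₁ : ℝ} (h : r₁ < r - (d : ℝ) / 2) : L2 d :=
  ⟨_, memlp_hopping h⟩

theorem norm_hoppingSeq_apply {r r₁ : ℝ} (h : r₁ < r - (d : ℝ) / 2) (k : ZLat d) :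
    ‖hoppingSeq h k‖ = ‖hopping d r k 0‖ * bracket k ^ r₁ := by
  change ‖hopping d r k 0 * ((bracket k ^ r₁ : ℝ) : ℂ)‖ = _
  rw [norm_mul, Complex.norm_real, Real.norm_of_nonneg (Real.rpow_nonneg (bracket_pos k).le _)]

/-- Recovers the ℓ² norm of the weighted hopping sequence from ‖T‖_{r₁}, so that the threshold scale
can be chosen before r. -/
theorem matSobolevNorm_hopping {r r₁ C₀ : ℝ} (hC : 0 ≤ C₀)
    (h : r₁ < r - (d : ℝ) / 2) :
    matSobolevNorm C₀ r₁ (restrict (hopping d r) Set.univ) = √C₀ * ‖hoppingSeq h‖ := by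
  have h1 : ∀ k : ZLat d, diagSup (restrict (hopping d r) Set.univ) k = ‖hopping d r k 0‖ := by
    intro k
    have hle : ∀ x y : (Set.univ : Set (ZLat d)), (x : ZLat d) - y = k →
        ‖restrict (hopping d r) Set.univ x y‖ = ‖hopping d r k 0‖ := by
      intro x y hxy
      rw [← hxy, ← hopping_translate]
      rfl
    refine le_antisymm (diagSup_le _ _ (norm_nonneg _) fun x y hxy => (hle x y hxy).le) ?_
    have h2 := le_diagSup_of_le (restrict (hopping d r) Set.univ) (c := ‖hopping d r k 0‖)
      ⟨k, mem_univ _⟩ ⟨0, mem_univ _⟩ fun x' y' hxy => (hle x' y' (by simpa using hxy)).le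
    simpa [restrict] using h2
  have h2 : matSobolevNorm C₀ r₁ (restrict (hopping d r) Set.univ) =
      √(C₀ * ∑' k, diagSup (restrict (hopping d r) Set.univ) k ^ 2 * bracket k ^ (2 * r₁)) := rfl
  have h3 : ∑' k, diagSup (restrict (hopping d r) Set.univ) k ^ 2 * bracket k ^ (2 * r₁) =
      ‖hoppingSeq h‖ ^ 2 := by
    rw [norm_L2_sq]
    refine tsum_congr fun k => ?_
    rw [norm_hoppingSeq_apply, mul_pow, bracket_rpow_sq, h1]
  rw [h2, h3, Real.sqrt_mul hC, Real.sqrt_sq (norm_nonneg _)]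

theorem sobNorm_hopping_le {X : Set (ZLat d)} [Finite X] {r r₁ s : ℝ}
    (h : r₁ < r - (d : ℝ) / 2) (hs : s ≤ r₁) :
    sobNorm s (restrict (hopping d r) X) ≤ ‖hoppingSeq h‖ := by
  refine (sobNorm_le_of_exponent_le hs _).trans (sobNorm_le fun x y => ?_)
  rw [norm_hoppingSeq_apply, ← hopping_translate]
  rfl

/-- Bounds the operator norm by the ℓ¹ norm of T(k, 0) and applies Cauchy–Schwarz. The range of
energies is thereby controlled by ‖T‖_{r₁}. -/
theorem norm_hoppingOp_le {r r₁ s₀ : ℝ} (h : r₁ < r - (d : ℝ) / 2)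
    (hs₀ : (d : ℝ) / 2 < s₀) (hs : s₀ ≤ r₁) :
    ‖hoppingOp d r‖ ≤ ‖bracketSeq hs₀‖ * ‖hoppingSeq h‖ := by
  unfold hoppingOp
  by_cases hsum : Summable fun k : ZLat d =>
      hopping d r k 0 • (translate (d := d) k).toContinuousLinearMap
  swap
  -- A divergent series has sum 0 by default, so the bound is trivial here.
  · rw [tsum_eq_zero_of_not_summable hsum, norm_zero]
    exact mul_nonneg (norm_nonneg _) (norm_nonneg _)
  refine le_of_tendsto hsum.hasSum.norm (Filter.Eventually.of_forall fun F => ?_)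
  refine (norm_sum_le _ _).trans ?_
  refine le_trans (Finset.sum_le_sum fun k _ =>
    (?_ : _ ≤ ‖bracketSeq hs₀ k‖ * ‖hoppingSeq h k‖)) ?_
  · rw [norm_smul, norm_bracketSeq_apply, norm_hoppingSeq_apply]
    have h1 : 1 ≤ bracket k ^ (-s₀) * bracket k ^ r₁ := by
      rw [← Real.rpow_add (bracket_pos k)]
      exact Real.one_le_rpow (one_le_bracket k) (by linarith)
    calc _ ≤ ‖hopping d r k 0‖ * 1 := by
          gcongr
          exact (translate k).norm_toContinuousLinearMap_le
      _ ≤ ‖hopping d r k 0‖ * (bracket k ^ (-s₀) * bracket k ^ r₁) := by gcongr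
      _ = _ := by ring
  refine abs_le_of_sq_le_sq' ?_ (mul_nonneg (norm_nonneg _) (norm_nonneg _)) |>.2
  refine (Finset.sum_mul_sq_le_sq_mul_sq _ _ _).trans ?_
  rw [mul_pow]
  exact mul_le_mul (sum_sq_le_norm_L2 _ F) (sum_sq_le_norm_L2 _ F)
    (Finset.sum_nonneg fun _ _ => sq_nonneg _) (sq_nonneg _)

theorem isHermitian_hamiltonian (r lam : ℝ) (v : ZLat d → ℝ) (X : Set (ZLat d)) :
    (restrict (hamiltonian d r lam v) X).IsHermitian := by
  refine Matrix.IsHermitian.ext fun x y => ?_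
  by_cases hxy : (x : ZLat d) = y
  · simp [restrict, hamiltonian, hopping, hxy]
  · have h1 : (y : ZLat d) ≠ x := fun e => hxy e.symm
    simp [restrict, hamiltonian, hopping, hxy, h1, norm_sub_rev (y : ZLat d) x]

end Hopping

/-! ### The approximate inverse glued from small Green's functions. -/

section LocalInverse

variable {d : ℕ} {L l : ℕ} {n : ZLat d}

open Classical in
/-- The matrix whose row at a site `x` outside `B` is the row at `x` of the Green's function of a
small cube around `κ x`, and whose rows in `B` vanish. -/
noncomputable def localInverse (H : Matrix (ZLat d) (ZLat d) ℂ) (l : ℕ) (E : ℝ)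
    (B : cube L n → Prop) (κ : cube L n → ZLat d) (hκ : ∀ x, (x : ZLat d) ∈ cube l (κ x)) :
    Matrix (cube L n) (cube L n) ℂ := fun x y =>
  if h : ¬ B x ∧ (y : ZLat d) ∈ cube l (κ x) then green H l (κ x) E ⟨x, hκ x⟩ ⟨y, h.2⟩ else 0

variable {H : Matrix (ZLat d) (ZLat d) ℂ} {E : ℝ} {B : cube L n → Prop} {κ : cube L n → ZLat d}
  {hκ : ∀ x, (x : ZLat d) ∈ cube l (κ x)}

theorem localInverse_apply_of_mem {x y : cube L n} (hx : ¬ B x)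
    (hy : (y : ZLat d) ∈ cube l (κ x)) :
    localInverse H l E B κ hκ x y = green H l (κ x) E ⟨x, hκ x⟩ ⟨y, hy⟩ :=
  dif_pos ⟨hx, hy⟩

theorem localInverse_apply_of_bad {x : cube L n} (hx : B x) (y : cube L n) :
    localInverse H l E B κ hκ x y = 0 :=
  dif_neg fun h => h.1 hx

theorem localInverse_apply_of_notMem {x y : cube L n} (hy : (y : ZLat d) ∉ cube l (κ x)) :
    localInverse H l E B κ hκ x y = 0 :=
  dif_neg fun h => hy h.2

theorem norm_sub_le_of_mem_cube {j x y : ZLat d} (hx : x ∈ cube l j) (hy : y ∈ cube l j) :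
    ‖x - y‖ ≤ 2 * l := by
  have h1 : x - y = (x - j) - (y - j) := by abel
  rw [h1]
  refine (norm_sub_le _ _).trans ?_
  have hx' : ‖x - j‖ ≤ l := hx
  have hy' : ‖y - j‖ ≤ l := hy
  linarith

theorem norm_sub_le_of_localInverse_ne_zero {x y : cube L n}
    (h : localInverse H l E B κ hκ x y ≠ 0) : ‖(x : ZLat d) - (y : ZLat d)‖ ≤ 2 * l := by
  by_cases hy : (y : ZLat d) ∈ cube l (κ x)
  · exact norm_sub_le_of_mem_cube (hκ x) hy
  · exact (h (localInverse_apply_of_notMem hy)).elim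

/-- Rows come from different small cubes, so only weighted entry bounds survive the gluing; the band
width 2l then costs (2l)^{s₀}. -/
theorem sobNorm_localInverse_le {s s₀ c : ℝ} (h : (d : ℝ) / 2 < s₀) (hl : 1 ≤ l) (hc : 0 ≤ c)
    (hgood : ∀ x, ¬ B x → sobNorm s (green H l (κ x) E) ≤ c) :
    sobNorm s (localInverse H l E B κ hκ) ≤ c * (2 * l : ℝ) ^ s₀ * ‖bracketSeq h‖ := by
  have hl' : (1 : ℝ) ≤ l := by exact_mod_cast hl
  refine sobNorm_le_of_near h (by linarith) hc _
    (fun x y hxy => norm_sub_le_of_localInverse_ne_zero hxy) fun x y => ?_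
  by_cases hx : B x
  · rw [localInverse_apply_of_bad hx, norm_zero, zero_mul]; exact hc
  by_cases hy : (y : ZLat d) ∈ cube l (κ x)
  · rw [localInverse_apply_of_mem hx hy]
    exact (le_sobNorm s (green H l (κ x) E) ⟨x, hκ x⟩ ⟨y, hy⟩).trans (hgood x hx)
  · rw [localInverse_apply_of_notMem hy, norm_zero, zero_mul]; exact hc

/-- The row at x vanishes off its small cube, so against a column of that cube it meets only the
small block, which it inverts exactly. -/
theorem localInverse_mul_apply_of_mem {x y : cube L n} (hx : ¬ B x)
    (hy : (y : ZLat d) ∈ cube l (κ x)) (hsub : cube l (κ x) ⊆ cube L n)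
    (hunit : IsUnit (restrict H (cube l (κ x)) - (E : ℂ) • 1)) :
    (localInverse H l E B κ hκ * (restrict H (cube L n) - (E : ℂ) • 1)) x y =
      (1 : Matrix (cube L n) (cube L n) ℂ) x y := by
  have h1 : green H l (κ x) E * (restrict H (cube l (κ x)) - (E : ℂ) • 1) = 1 :=
    Matrix.nonsing_inv_mul _ ((Matrix.isUnit_iff_isUnit_det _).mp hunit)
  have h2 := congrFun (congrFun h1 ⟨x, hκ x⟩) ⟨y, hy⟩
  rw [Matrix.mul_apply] at h2 ⊢
  have h3 : (1 : Matrix (cube l (κ x)) (cube l (κ x)) ℂ) ⟨x, hκ x⟩ ⟨y, hy⟩ =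
      (1 : Matrix (cube L n) (cube L n) ℂ) x y := by
    simp only [Matrix.one_apply, Subtype.ext_iff]
  rw [← h3, ← h2]
  symm
  refine Fintype.sum_of_injective (Set.inclusion hsub) (Set.inclusion_injective hsub)
    (fun z => green H l (κ x) E ⟨x, hκ x⟩ z * (restrict H (cube l (κ x)) - (E : ℂ) • 1) z ⟨y, hy⟩)
    (fun z => localInverse H l E B κ hκ x z * (restrict H (cube L n) - (E : ℂ) • 1) z y)
    (fun z hz => ?_) fun z => ?_
  · have : (z : ZLat d) ∉ cube l (κ x) := fun hm =>
      hz ⟨⟨z, hm⟩, Subtype.ext rfl⟩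
    rw [localInverse_apply_of_notMem this, zero_mul]
  · have hz : ((Set.inclusion hsub z : cube L n) : ZLat d) ∈ cube l (κ x) := z.2
    rw [localInverse_apply_of_mem hx hz]
    refine congrArg₂ _ rfl ?_
    simp only [Matrix.sub_apply, Matrix.smul_apply, Matrix.one_apply, Subtype.ext_iff, restrict,
      Matrix.submatrix_apply]

/-- For a column outside the small cube only off-diagonal entries of `H` occur. The error is thus
dominated by a product with the hopping matrix, to which the tame estimate applies. -/
theorem norm_localInverse_mul_apply_le {x y : cube L n} {T : Matrix (ZLat d) (ZLat d) ℂ}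
    (hT : ∀ j k, j ≠ k → ‖H j k‖ ≤ ‖T j k‖) (hy : (y : ZLat d) ∉ cube l (κ x)) :
    ‖(localInverse H l E B κ hκ * (restrict H (cube L n) - (E : ℂ) • 1)) x y‖ ≤
      ∑ z, ‖localInverse H l E B κ hκ x z‖ * ‖restrict T (cube L n) z y‖ := by
  rw [Matrix.mul_apply]
  refine (norm_sum_le _ _).trans (Finset.sum_le_sum fun z _ => ?_)
  rw [norm_mul]
  by_cases hz : (z : ZLat d) ∈ cube l (κ x)
  · have hzy : (z : ZLat d) ≠ y := fun e => hy (e ▸ hz)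
    have hzy' : z ≠ y := fun e => hzy (congrArg Subtype.val e)
    refine mul_le_mul_of_nonneg_left ?_ (norm_nonneg _)
    rw [Matrix.sub_apply, Matrix.smul_apply, Matrix.one_apply_ne hzy', smul_zero, sub_zero]
    exact hT _ _ hzy
  · rw [localInverse_apply_of_notMem hz, norm_zero, zero_mul, zero_mul]

end LocalInverse

/-! ### Bounds on H − E, uniform in λ ≥ 1. -/

section Hamiltonian

variable {d : ℕ}

theorem norm_hamiltonian_le {r lam : ℝ} (hlam : 1 ≤ lam) (v : ZLat d → ℝ) (j k : ZLat d)
    (hjk : j ≠ k) : ‖hamiltonian d r lam v j k‖ ≤ ‖hopping d r j k‖ := by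
  rw [hamiltonian, Matrix.add_apply, Matrix.diagonal_apply_ne _ hjk, add_zero, Matrix.smul_apply,
    norm_smul, Complex.norm_real, Real.norm_of_nonneg (by positivity)]
  exact mul_le_of_le_one_left (norm_nonneg _) (inv_le_one_of_one_le₀ hlam)

theorem sobNorm_hamiltonian_sub_le {L : ℕ} {n : ZLat d} {r r₁ s lam M E e₀ : ℝ}
    (h : r₁ < r - (d : ℝ) / 2) (hs : s ≤ r₁) (hlam : 1 ≤ lam) {v : ZLat d → ℝ} (hM : 0 ≤ M)
    (hv : ∀ k, |v k| ≤ M) (hE : |E| ≤ e₀) :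
    sobNorm s (restrict (hamiltonian d r lam v) (cube L n) - (E : ℂ) • 1) ≤
      ‖hoppingSeq h‖ + (M + e₀) := by
  have e : restrict (hamiltonian d r lam v) (cube L n) - (E : ℂ) • 1 =
      ((lam⁻¹ : ℝ) : ℂ) • restrict (hopping d r) (cube L n) +
        Matrix.diagonal fun x : cube L n => ((v x - E : ℝ) : ℂ) := by
    ext x y
    by_cases hxy : x = y
    · subst hxy
      simp [restrict, hamiltonian, add_sub]
    · have hxy' : (x : ZLat d) ≠ y := fun e => hxy (Subtype.ext e)
      simp [restrict, hamiltonian, hxy, hxy']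
  rw [e]
  refine (sobNorm_add_le _ _ _).trans (add_le_add ?_ ?_)
  · refine le_trans (sobNorm_mono fun x y => ?_) (sobNorm_hopping_le h hs)
    rw [Matrix.smul_apply, norm_smul, Complex.norm_real, Real.norm_of_nonneg (by positivity)]
    exact mul_le_of_le_one_left (norm_nonneg _) (inv_le_one_of_one_le₀ hlam)
  · have he : 0 ≤ e₀ := (abs_nonneg _).trans hE
    refine sobNorm_diagonal_le s _ (by positivity) fun x => ?_
    rw [Complex.norm_real, Real.norm_eq_abs]
    exact (abs_sub _ _).trans (add_le_add (hv x) hE)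

end Hamiltonian

/-! ### Large-scale thresholds and covers of the bad centres. -/

section Good

variable {d : ℕ}

theorem eventually_mul_rpow_le (c : ℝ) {e : ℝ} (he : e < 0) :
    ∀ᶠ x : ℝ in Filter.atTop, c * x ^ e ≤ 1 := by
  have h1 := (tendsto_rpow_neg_atTop (y := -e) (by linarith)).const_mul c
  rw [mul_zero, neg_neg] at h1
  exact h1.eventually_le_const one_pos

/-- A maximal separated family of bad centres covers all bad centres. -/
theorem exists_cover_bad {L l J : ℕ} {n : ZLat d} {bad : ZLat d → Prop}
    (hJ : ∀ K : Finset (ZLat d), (K : Set (ZLat d)) ⊆ cube L n → (∀ k ∈ K, bad k) →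
      (K : Set (ZLat d)).Pairwise (fun a b => 2 * (l : ℝ) < ‖a - b‖) → K.card < J) :
    ∃ K : Finset (ZLat d), K.card < J ∧ ∀ k ∈ cube L n, bad k → ∃ j ∈ K, ‖k - j‖ ≤ 2 * l := by
  classical
  let good : Finset (ZLat d) → Prop := fun K => (K : Set (ZLat d)) ⊆ cube L n ∧
    (∀ k ∈ K, bad k) ∧ (K : Set (ZLat d)).Pairwise fun a b => 2 * (l : ℝ) < ‖a - b‖
  have hfin : {K | good K}.Finite := by
    refine ((cube_finite L n).toFinset.powerset.finite_toSet).subset fun K hK => ?_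
    rw [Finset.mem_coe, Finset.mem_powerset]
    intro k hk
    rw [Set.Finite.mem_toFinset]
    exact hK.1 hk
  obtain ⟨K, hK⟩ := hfin.exists_maximal ⟨∅, by simp [good]⟩
  refine ⟨K, hJ K hK.1.1 hK.1.2.1 hK.1.2.2, fun k hk hbad => ?_⟩
  by_contra! hfar
  have hkK : k ∉ K := fun hm => by
    have := hfar k hm
    rw [sub_self, norm_zero] at this
    have : (0 : ℝ) ≤ l := Nat.cast_nonneg l
    linarith
  have hins : good (insert k K) := by
    refine ⟨?_, ?_, ?_⟩
    · rw [Finset.coe_insert]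
      exact Set.insert_subset hk hK.1.1
    · intro j hj
      rcases Finset.mem_insert.mp hj with rfl | hj
      exacts [hbad, hK.1.2.1 j hj]
    · rw [Finset.coe_insert]
      refine hK.1.2.2.insert fun j hj _ => ⟨hfar j hj, ?_⟩
      rw [norm_sub_rev]
      exact hfar j hj
  exact hkK (hK.2 hins (Finset.subset_insert k K) (Finset.mem_insert_self k K))

end Good

/-! ### The deterministic multiscale step. -/

section MultiScale

/-- The arithmetic of the exponents in the last step of the coupling estimate. -/
theorem coupling_exponents {α τ ξ τ' δ s₀ r₁ s x L k C : ℝ} (hα : 1 < α) (hτ : 1 < τ)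
    (hξ : 0 < ξ) (hτ' : 1 < τ') (hδ : 0 < δ) (hδ1 : δ < 1) (hs₀ : 0 < s₀) (hs : s₀ ≤ s)
    (hsr : s ≤ r₁) (hξα : 1 + ξ < α) (hx : 1 ≤ x) (hL : x ^ α ≤ 2 * L) (hL0 : 0 ≤ L)
    (hk : 0 ≤ k) (hC : 0 ≤ C)
    (hlarge : C * 2420 * k ^ 15 * 2 ^ (τ' + r₁) *
      x ^ (-(α * τ' - (2 * τ' + 2 * α * τ + (5 + 4 * ξ + 2 * δ) * s₀) - α * s₀)) ≤ 1) :
    C * (1210 * k ^ 15 * (x ^ (α * τ + (1 + ξ) * (s + s₀)) +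
      (x ^ (α * τ + (1 + ξ) * (s₀ + s₀))) ^ 2 * x ^ (s₀ + τ' + δ * s)) * x ^ (s₀ + τ' + δ * s₀)) ≤
      L ^ (τ' + (1 + ξ) / α * s) := by
  have hx0 : 0 < x := by linarith
  -- This is α times the slack in the third parameter inequality.
  set ε := α * τ' - (2 * τ' + 2 * α * τ + (5 + 4 * ξ + 2 * δ) * s₀) - α * s₀ with hε
  set θ := τ' + (1 + ξ) / α * s with hθ
  have hαθ : α * θ = α * τ' + (1 + ξ) * s := by rw [hθ]; field_simp
  have hατ : 1 < α * τ := by nlinarith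
  have b1 : x ^ (α * τ + (1 + ξ) * (s + s₀)) * x ^ (s₀ + τ' + δ * s₀) ≤ x ^ (α * θ + -ε) := by
    rw [← Real.rpow_add hx0]
    refine Real.rpow_le_rpow_of_exponent_le hx ?_
    rw [hαθ, hε]
    nlinarith [mul_pos hξ hs₀, mul_pos hδ hs₀, mul_pos (by linarith : 0 < α) hs₀]
  have b2 : (x ^ (α * τ + (1 + ξ) * (s₀ + s₀))) ^ 2 * x ^ (s₀ + τ' + δ * s) *
      x ^ (s₀ + τ' + δ * s₀) ≤ x ^ (α * θ + -ε) := by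
    rw [← Real.rpow_natCast (x ^ _), ← Real.rpow_mul hx0.le, ← Real.rpow_add hx0,
      ← Real.rpow_add hx0]
    refine Real.rpow_le_rpow_of_exponent_le hx ?_
    rw [hαθ, hε]
    push_cast
    nlinarith [mul_pos hξ hs₀, mul_pos hδ hs₀, mul_pos (by linarith : 0 < α - 1) hs₀,
      mul_pos (by linarith : 0 < 1 + ξ - δ) (by linarith : 0 < s), mul_nonneg hδ.le (sub_nonneg.mpr hs)]
  have hθ0 : 0 ≤ θ := by
    have : 0 ≤ (1 + ξ) / α * s := by
      have : 0 < α := by linarith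
      have : 0 < s := by linarith
      positivity
    rw [hθ]; linarith
  have hθ1 : θ ≤ τ' + r₁ := by
    have h1 : (1 + ξ) / α ≤ 1 := (div_le_one (by linarith)).mpr hξα.le
    have h2 : (1 + ξ) / α * s ≤ 1 * s := by gcongr; linarith
    rw [hθ]; linarith
  -- Rounding L to an integer costs a factor 2; the bound θ ≤ τ' + r₁, where 1 + ξ < α enters, keeps
  -- its power uniform in s.
  have b3 : x ^ (α * θ) ≤ 2 ^ (τ' + r₁) * L ^ θ := by
    calc x ^ (α * θ) = (x ^ α) ^ θ := Real.rpow_mul hx0.le _ _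
      _ ≤ (2 * L) ^ θ := by gcongr
      _ = 2 ^ θ * L ^ θ := Real.mul_rpow (by norm_num) hL0
      _ ≤ _ := by gcongr; norm_num
  calc _ = C * 1210 * k ^ 15 * (x ^ (α * τ + (1 + ξ) * (s + s₀)) * x ^ (s₀ + τ' + δ * s₀) +
        (x ^ (α * τ + (1 + ξ) * (s₀ + s₀))) ^ 2 * x ^ (s₀ + τ' + δ * s) *
          x ^ (s₀ + τ' + δ * s₀)) := by ring
    _ ≤ C * 1210 * k ^ 15 * (x ^ (α * θ + -ε) + x ^ (α * θ + -ε)) := by gcongr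
    _ = C * 2420 * k ^ 15 * x ^ (-ε) * x ^ (α * θ) := by rw [Real.rpow_add hx0]; ring
    _ ≤ C * 2420 * k ^ 15 * x ^ (-ε) * (2 ^ (τ' + r₁) * L ^ θ) := by gcongr
    _ = (C * 2420 * k ^ 15 * 2 ^ (τ' + r₁) * x ^ (-ε)) * L ^ θ := by ring
    _ ≤ 1 * L ^ θ := by gcongr
    _ = _ := one_mul _

variable {d : ℕ}

set_option maxHeartbeats 1000000 in
/-- The deterministic multi-scale step: a large cube with few bad subcubes whose spectrum is not
too close to the energy is good. -/
theorem exists_isGood_of_few_bad {s₀ C₀ : ℝ} (h : (d : ℝ) / 2 < s₀) (hC : 0 < C₀)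
    {t M α τ ξ τ' δ r₁ : ℝ} {J : ℕ} (hM : 0 < M) (hα : 1 < α) (hτ : 1 < τ) (hξ : 0 < ξ)
    (hτ' : 1 < τ') (hδ : 0 < δ) (hδ1 : δ < 1) (hsr₁ : s₀ ≤ r₁)
    (hc1 : -(1 - δ) * r₁ + τ' + 2 * s₀ < 0)
    (hc2 : -ξ * r₁ + τ' + α * τ + (3 + δ + 4 * ξ) * s₀ < 0)
    (hc3 : α⁻¹ * (2 * τ' + 2 * α * τ + (5 + 4 * ξ + 2 * δ) * s₀) + s₀ < τ') (hξα : 1 + ξ < α) :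
    ∃ l₀ : ℝ, 2 ≤ l₀ ∧ ∀ r : ℝ, r₁ < r - (d : ℝ) / 2 →
      matSobolevNorm C₀ r₁ (restrict (hopping d r) Set.univ) = t → ∀ lam : ℝ, 1 ≤ lam →
      ∀ v : ZLat d → ℝ, (∀ k, |v k| ≤ M) → ∀ E : ℝ, |E| ≤ ‖hoppingOp d r‖ + M + 1 →
      ∀ l L : ℕ, L = ⌊(l : ℝ) ^ α⌋₊ → l₀ ≤ l → ∀ n : ZLat d,
      (∀ K : Finset (ZLat d), (K : Set (ZLat d)) ⊆ cube L n →
        (∀ k ∈ K, ¬ IsGood C₀ s₀ r₁ τ' (hamiltonian d r lam v) E δ l k) →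
        (K : Set (ZLat d)).Pairwise (fun a b => 2 * (l : ℝ) < ‖a - b‖) → K.card < J) →
      (∀ a ∈ spectrum ℂ (restrict (hamiltonian d r lam v) (cube L n)),
        (L : ℝ) ^ (-τ) ≤ ‖a - E‖) →
      IsGood C₀ s₀ r₁ τ' (hamiltonian d r lam v) E ((1 + ξ) / α) L n := by
  have hd : (0 : ℝ) ≤ d := Nat.cast_nonneg d
  have hs₀ : 0 < s₀ := by linarith
  have hα0 : 0 < α := by linarith
  have hsC : 0 < √C₀ := Real.sqrt_pos.mpr hC
  set K₀ := ‖bracketSeq h‖ with hK₀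
  have hK₀1 : 1 ≤ K₀ := one_le_norm_bracketSeq h
  set t₁ := |t| / √C₀ with ht₁
  have ht₁0 : 0 ≤ t₁ := by positivity
  set a := t₁ + (M + (K₀ * t₁ + M + 1)) with ha
  set c₁ := (√C₀)⁻¹ * 2 ^ s₀ * K₀ with hc₁
  set κ := 2 ^ r₁ * K₀ with hκ
  set c₂ := 2 * κ * c₁ * t₁ with hc₂
  set c₉ := (6 * (J + 1) : ℝ) ^ (2 * r₁) * K₀ with hc₉
  have ha0 : 0 ≤ a := by positivity
  have hc₁0 : 0 ≤ c₁ := by positivity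
  have hκ0 : 0 ≤ κ := by positivity
  have hc₂0 : 0 ≤ c₂ := by positivity
  have hc₉0 : 0 ≤ c₉ := by positivity
  -- One constant dominating all others. It is built from the parameters and `t` alone, so the
  -- threshold does not depend on λ, the potential, the energy or r.
  set k := 1 + κ + a + c₁ + c₂ + c₉ with hk
  have hk1 : 1 ≤ k := by linarith
  have hk0 : 0 ≤ k := by linarith
  -- The conditions in order: P is small (first inequality), Z is small (first and second), the
  -- final exponent fits (third), and 3l ≤ l^{1+ξ}.
  have hev := (eventually_mul_rpow_le (4 * k ^ 2) (e := -(1 - δ) * r₁ + τ' + 2 * s₀) hc1).and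
    ((eventually_mul_rpow_le (96 * k ^ 7) (e := α * τ + (1 + ξ) * (s₀ + s₀) +
      -((1 + ξ) * (r₁ - s₀)) + (s₀ + τ' + δ * r₁)) (by
        linarith [mul_pos hξ hs₀, mul_pos hδ hs₀])).and
    ((eventually_mul_rpow_le (√C₀ * 2420 * k ^ 15 * 2 ^ (τ' + r₁))
      (e := -(α * τ' - (2 * τ' + 2 * α * τ + (5 + 4 * ξ + 2 * δ) * s₀) - α * s₀)) (by
        have h1 := mul_lt_mul_of_pos_left hc3 hα0
        rw [mul_add, mul_inv_cancel_left₀ hα0.ne'] at h1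
        linarith)).and
    ((eventually_mul_rpow_le 3 (e := -ξ) (by linarith)).and (Filter.eventually_ge_atTop (2 : ℝ)))))
  obtain ⟨l₀, hl₀⟩ := Filter.eventually_atTop.mp hev
  refine ⟨max 2 l₀, le_max_left _ _, ?_⟩
  intro r hr₁ ht lam hlam v hv E hE l L hL hl n hfew hspec
  obtain ⟨L1, L2', L3, L4, hl2⟩ := hl₀ l ((le_max_right _ _).trans hl)
  clear hev hl₀
  obtain ⟨x, hx⟩ : ∃ x : ℝ, x = (l : ℝ) := ⟨_, rfl⟩
  rw [← hx] at L1 L2' L3 L4 hl2 hL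
  clear_value k
  have hx0 : 0 < x := by linarith
  have hx1 : 1 ≤ x := by linarith
  obtain ⟨H, hH⟩ : ∃ H, H = hamiltonian d r lam v := ⟨_, rfl⟩
  rw [← hH] at hfew hspec ⊢
  obtain ⟨A, hA⟩ : ∃ A, A = restrict H (cube L n) - (E : ℂ) • (1 : Matrix (cube L n) (cube L n) ℂ) :=
    ⟨_, rfl⟩
  -- sizes of the two scales
  have hxα : x ≤ x ^ α := by
    calc x = x ^ (1 : ℝ) := (Real.rpow_one x).symm
      _ ≤ x ^ α := Real.rpow_le_rpow_of_exponent_le hx1 hα.le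
  have hlL : l ≤ L := by rw [hL]; exact Nat.le_floor (hx ▸ hxα)
  have hL1 : 1 ≤ (L : ℝ) := by
    have : x ≤ (L : ℝ) := by rw [hx]; exact_mod_cast hlL
    linarith
  have hLle : (L : ℝ) ≤ x ^ α := by rw [hL]; exact Nat.floor_le (by positivity)
  have hLge : x ^ α ≤ 2 * L := by
    have := Nat.lt_floor_add_one (x ^ α)
    rw [← hL] at this
    linarith
  -- the hopping term
  have htseq : ‖hoppingSeq hr₁‖ = t₁ := by
    rw [matSobolevNorm_hopping hC.le hr₁] at ht
    rw [ht₁, ← ht, abs_of_nonneg (by positivity)]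
    field_simp
  have hE' : |E| ≤ K₀ * t₁ + M + 1 := by
    have := norm_hoppingOp_le hr₁ h hsr₁
    rw [htseq] at this
    linarith
  have hAnorm : ∀ s, s ≤ r₁ → sobNorm s A ≤ k := fun s hs => by
    have := sobNorm_hamiltonian_sub_le (L := L) (n := n) hr₁ hs hlam hM.le hv hE'
    rw [htseq, ← hH, ← hA] at this
    exact this.trans (by linarith)
  have hT : ∀ s, s ≤ r₁ → sobNorm s (restrict (hopping d r) (cube L n)) ≤ t₁ := fun s hs => by
    have := sobNorm_hopping_le (X := cube L n) hr₁ hs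
    rwa [htseq] at this
  -- the Green's function of the large cube
  have hη : 0 < (L : ℝ) ^ (-τ) := Real.rpow_pos_of_pos (by linarith) _
  have hHerm := isHermitian_hamiltonian r lam v (cube L n)
  rw [← hH] at hHerm
  have hAunit : IsUnit A := by rw [hA]; exact isUnit_of_spectrum hη hspec
  have hGA : green H L n E * A = 1 := by
    rw [green, ← hA]
    exact Matrix.nonsing_inv_mul _ ((Matrix.isUnit_iff_isUnit_det _).mp hAunit)
  have hηinv : ((L : ℝ) ^ (-τ))⁻¹ ≤ x ^ (α * τ) := by
    rw [Real.rpow_neg (by linarith), inv_inv, Real.rpow_mul hx0.le]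
    gcongr
  refine ⟨hA ▸ hAunit, fun s hs => ?_⟩
  obtain ⟨hs1, hs2⟩ := hs
  rw [matSobolevNorm_eq hC.le]
  -- bad sites
  choose κx hκ1 hκ2 hκ3 hκ4 using fun y : cube L n => exists_subcube hlL y.2
  classical
  let B : cube L n → Prop := fun y => ¬ IsGood C₀ s₀ r₁ τ' H E δ l (κx y)
  obtain ⟨K, hKJ, hKcov⟩ := exists_cover_bad hfew
  -- This scale exceeds 3l: a bad site is within l of the centre of its subcube, which is within 2l
  -- of the covering family.
  obtain ⟨ρ, hρ⟩ : ∃ ρ, ρ = x ^ (1 + ξ) := ⟨_, rfl⟩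
  have hρ1 : 1 ≤ ρ := hρ ▸ Real.one_le_rpow hx1 (by linarith)
  have hρ3 : 3 * x ≤ ρ := by
    rw [Real.rpow_neg hx0.le, ← div_eq_mul_inv, div_le_one (by positivity)] at L4
    rw [hρ, Real.rpow_add hx0, Real.rpow_one, mul_comm]
    gcongr
  obtain ⟨ι, c', hc'⟩ := exists_label K (ρ := ρ) (by linarith)
  let c : cube L n → ι := fun y => c' y
  have hcB : ∀ y : cube L n, B y → ∀ z : cube L n,
      (c z ≠ c y → ρ ≤ ‖(z : ZLat d) - (y : ZLat d)‖) ∧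
      (c z = c y → ‖(z : ZLat d) - (y : ZLat d)‖ ≤ 6 * (J + 1) * ρ) := by
    intro y hy z
    obtain ⟨j, hjK, hj⟩ := hKcov _ (hκ1 y) hy
    have h1 : ‖(y : ZLat d) - κx y‖ ≤ x := hx ▸ hκ3 y
    rw [← hx] at hj
    have h2 : (y : ZLat d) - j = (y - κx y) + (κx y - j) := by abel
    obtain ⟨h3, h4⟩ := hc' y ⟨j, hjK, by
      rw [h2]; exact (norm_add_le _ _).trans (by linarith)⟩ z
    refine ⟨h3, fun e => (h4 e).trans ?_⟩
    have : (K.card : ℝ) ≤ J := by exact_mod_cast hKJ.le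
    gcongr
  -- the local inverse
  obtain ⟨S, hS⟩ : ∃ S, S = localInverse H l E B κx hκ3 := ⟨_, rfl⟩
  have hσ1 : ∀ s, s₀ ≤ s → 1 ≤ x ^ (s₀ + τ' + δ * s) := fun s hs =>
    Real.one_le_rpow hx1 (by have := mul_nonneg hδ.le (hs₀.le.trans hs); linarith)
  have hSn : ∀ s, s₀ ≤ s → s ≤ r₁ → sobNorm s S ≤ c₁ * x ^ (s₀ + τ' + δ * s) := by
    intro s hs hs'
    have hl1 : 1 ≤ l := by rw [hx] at hx1; exact_mod_cast hx1
    rw [hS]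
    refine (sobNorm_localInverse_le (c := (√C₀)⁻¹ * x ^ (τ' + δ * s)) h hl1 (by positivity)
      fun y hy => ?_).trans (le_of_eq ?_)
    · have h1 := (not_not.mp hy).2 s ⟨hs, hs'⟩
      rw [matSobolevNorm_eq hC.le] at h1
      rw [inv_mul_eq_div, le_div_iff₀ hsC, mul_comm, hx]
      exact h1
    · rw [← hx, Real.mul_rpow (by norm_num) hx0.le, hc₁, add_assoc s₀, Real.rpow_add hx0 s₀]
      ring
  have hκs : ∀ s, s ≤ r₁ → 2 ^ s * ‖bracketSeq h‖ ≤ κ := fun s hs => by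
    rw [hκ]; gcongr; norm_num
  -- P vanishes on rows in `B` and on columns inside the small cube of the row. By `hκ4`, any other
  -- column is at distance at least l.
  obtain ⟨P, hP⟩ : ∃ P, P = S * A + siteProj B - 1 := ⟨_, rfl⟩
  have hPrb : ∀ y z, B y → P y z = 0 := by
    intro y z hy
    have h1 : (S * A) y z = 0 := by
      rw [Matrix.mul_apply]
      exact Finset.sum_eq_zero fun w _ => by
        rw [hS, localInverse_apply_of_bad hy, zero_mul]
    rw [hP, Matrix.sub_apply, Matrix.add_apply, h1, zero_add, siteProj]
    by_cases hyz : y = z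
    · subst hyz; simp [hy]
    · simp [hyz]
  have hPgood : ∀ y z, ¬ B y → P y z = (S * A) y z - (1 : Matrix (cube L n) (cube L n) ℂ) y z := by
    intro y z hy
    rw [hP, Matrix.sub_apply, Matrix.add_apply, siteProj]
    by_cases hyz : y = z
    · subst hyz; simp [hy]
    · simp [hyz]
  have hPnear : ∀ y z : cube L n, (z : ZLat d) ∈ cube l (κx y) → P y z = 0 := by
    intro y z hz
    by_cases hy : B y
    · exact hPrb y z hy
    · rw [hPgood y z hy, hS, hA,
        localInverse_mul_apply_of_mem hy hz (hκ2 y) (not_not.mp hy).1, sub_self]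
  have hPle : ∀ y z : cube L n, ‖P y z‖ ≤ ∑ w, ‖S y w‖ * ‖restrict (hopping d r) (cube L n) w z‖ := by
    intro y z
    by_cases hz : (z : ZLat d) ∈ cube l (κx y)
    · rw [hPnear y z hz, norm_zero]
      exact Finset.sum_nonneg fun _ _ => by positivity
    by_cases hy : B y
    · rw [hPrb y z hy, norm_zero]
      exact Finset.sum_nonneg fun _ _ => by positivity
    have hyz : y ≠ z := fun e => hz (e ▸ hκ3 y)
    rw [hPgood y z hy, Matrix.one_apply_ne hyz, sub_zero, hS, hA, hH]
    exact norm_localInverse_mul_apply_le (norm_hamiltonian_le hlam v) hz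
  have hPn : ∀ s, s₀ ≤ s → s ≤ r₁ → sobNorm s P ≤ k * x ^ (s₀ + τ' + δ * s) := by
    intro s hs hs'
    have h1 := sobNorm_le_of_le_mul h (hs₀.le.trans hs) S _ P hPle
    have h2 : x ^ (s₀ + τ' + δ * s₀) ≤ x ^ (s₀ + τ' + δ * s) :=
      Real.rpow_le_rpow_of_exponent_le hx1 (by
        have := mul_le_mul_of_nonneg_left hs hδ.le; linarith)
    have h3 := hSn s hs hs'
    have h4 := hSn s₀ le_rfl hsr₁
    have h5 := hT s hs'
    have h6 := hT s₀ hsr₁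
    have h7 := sobNorm_nonneg s S
    have h8 := sobNorm_nonneg s₀ S
    have h9 := sobNorm_nonneg s (restrict (hopping d r) (cube L n))
    have h10 := sobNorm_nonneg s₀ (restrict (hopping d r) (cube L n))
    calc sobNorm s P ≤ _ := h1
      _ ≤ κ * (c₁ * x ^ (s₀ + τ' + δ * s) * t₁ + c₁ * x ^ (s₀ + τ' + δ * s) * t₁) := by
          gcongr
          · exact hκs s hs'
          · exact h4.trans (by gcongr)
      _ = c₂ * x ^ (s₀ + τ' + δ * s) := by rw [hc₂]; ring
      _ ≤ _ := by gcongr; linarith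
  have hPfar : ∀ y z : cube L n, P y z ≠ 0 → x ≤ ‖(y : ZLat d) - (z : ZLat d)‖ := by
    intro y z hyz
    by_contra! hlt
    exact hyz (hPnear y z (hκ4 y z z.2 (hx ▸ hlt.le)))
  have hP₀ : 4 * k * sobNorm s₀ P ≤ 1 := by
    refine le_trans ?_ L1
    calc 4 * k * sobNorm s₀ P ≤ 4 * k * (x ^ (-(r₁ - s₀)) * (k * x ^ (s₀ + τ' + δ * r₁))) := by
          gcongr
          refine (sobNorm_le_of_far hsr₁ hx0 P hPfar).trans ?_
          gcongr
          exact hPn r₁ hsr₁ le_rfl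
      _ = 4 * k ^ 2 * (x ^ (-(r₁ - s₀)) * x ^ (s₀ + τ' + δ * r₁)) := by ring
      _ = _ := by
          rw [← Real.rpow_add hx0]
          congr 2; ring
  -- the off-diagonal blocks
  obtain ⟨D, hD⟩ : ∃ D, D = offBlock c (A * (1 + P)⁻¹ * siteProj B) := ⟨_, rfl⟩
  have hkappa : ∀ s, s ≤ r₁ → 2 ^ s * ‖bracketSeq h‖ ≤ k := fun s hs =>
    (hκs s hs).trans (by linarith)
  -- The factor `siteProj B` confines columns to bad sites, where distinct labels mean distance at
  -- least ρ.
  have hDfar : ∀ y z : cube L n, D y z ≠ 0 → ρ ≤ ‖(y : ZLat d) - (z : ZLat d)‖ := by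
    intro y z hyz
    by_cases hc : c y = c z
    · exact (hyz (by rw [hD, offBlock, if_pos hc])).elim
    by_cases hz : B z
    · exact (hcB z hz y).1 hc
    · exact (hyz (by rw [hD, offBlock, if_neg hc, mul_siteProj_apply, if_neg hz])).elim
  have hDn : sobNorm s₀ D ≤ ρ ^ (-(r₁ - s₀)) * (8 * k ^ 4 * x ^ (s₀ + τ' + δ * r₁)) := by
    refine (sobNorm_le_of_far hsr₁ (by linarith) D hDfar).trans ?_
    gcongr
    rw [hD]
    exact (sobNorm_mono (norm_offBlock_le c _)).trans (sobNorm_mul_inv_mul_siteProj_le h hsr₁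
      (hkappa r₁ le_rfl) hk1 (hσ1 r₁ hsr₁) B (hAnorm r₁ le_rfl) (hPn r₁ hsr₁ le_rfl) hP₀)
  have hJ1 : (1 : ℝ) ≤ 6 * (J + 1) := by
    have : (0 : ℝ) ≤ J := Nat.cast_nonneg J
    linarith
  -- Cutting to blocks leaves a band of width 6(J+1)ρ, which turns entry bounds from the ℓ²
  -- resolvent estimate into Sobolev bounds. It is applied to G and to G D.
  have hcut : ∀ (N : Matrix (cube L n) (cube L n) ℂ) (b : ℝ), 0 ≤ b →
      (∀ y z, ‖N y z‖ ≤ x ^ (α * τ) * b) → ∀ s, s₀ ≤ s → s ≤ r₁ →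
      sobNorm s (blockCut B c N) ≤ k * x ^ (α * τ + (1 + ξ) * (s + s₀)) * b := by
    intro N b hb hN s hs hs'
    have h1 := sobNorm_le_of_near_of_le (s := s) (ρ := 6 * (J + 1) * ρ) (c := x ^ (α * τ) * b) h
      (hs₀.le.trans hs) (one_le_mul_of_one_le_of_one_le hJ1 hρ1) (by positivity) (blockCut B c N)
      (fun y z hyz => ?_) fun y z => (norm_blockCut_le B c N y z).trans (hN y z)
    · refine h1.trans ?_
      have h2 : (6 * (J + 1) * ρ : ℝ) ^ (s + s₀) =
          (6 * (J + 1) : ℝ) ^ (s + s₀) * x ^ ((1 + ξ) * (s + s₀)) := by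
        rw [Real.mul_rpow (by linarith) (by linarith), hρ, ← Real.rpow_mul hx0.le]
      have h3 : (6 * (J + 1) : ℝ) ^ (s + s₀) ≤ (6 * (J + 1) : ℝ) ^ (2 * r₁) :=
        Real.rpow_le_rpow_of_exponent_le hJ1 (by linarith)
      rw [h2, Real.rpow_add hx0 (α * τ)]
      calc _ ≤ x ^ (α * τ) * b * ((6 * (J + 1) : ℝ) ^ (2 * r₁) * x ^ ((1 + ξ) * (s + s₀))) * K₀ := by
            gcongr
        _ = c₉ * (x ^ (α * τ) * x ^ ((1 + ξ) * (s + s₀))) * b := by rw [hc₉]; ring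
        _ ≤ _ := by gcongr; linarith
    · by_cases hyz' : B y ∧ c y = c z
      · rw [norm_sub_rev]
        exact (hcB y hyz'.1 z).2 hyz'.2.symm
      · exact (hyz (if_neg hyz')).elim
  have hGentry : ∀ y z, ‖green H L n E y z‖ ≤ x ^ (α * τ) * 1 := by
    intro y z
    have h1 := norm_inv_mul_apply_le hHerm hη hspec (1 : Matrix (cube L n) (cube L n) ℂ) y z
      zero_le_one (by
        rw [Finset.sum_eq_single z (fun w _ hw => by rw [Matrix.one_apply_ne hw]; simp) (by simp)]
        simp)
    rw [Matrix.mul_one] at h1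
    exact h1.trans (by gcongr)
  have hGDentry : ∀ y z, ‖(green H L n E * D) y z‖ ≤ x ^ (α * τ) * sobNorm s₀ D := by
    intro y z
    have h1 := norm_inv_mul_apply_le hHerm hη hspec D y z (sobNorm_nonneg s₀ D)
      (sum_norm_sq_col_le hs₀.le D z)
    refine h1.trans ?_
    have := sobNorm_nonneg s₀ D
    gcongr
  have hsmall : 12 * k ^ 3 * x ^ (α * τ + (1 + ξ) * (s₀ + s₀)) * sobNorm s₀ D ≤ 1 := by
    refine le_trans ?_ L2'
    calc _ ≤ 12 * k ^ 3 * x ^ (α * τ + (1 + ξ) * (s₀ + s₀)) *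
          (ρ ^ (-(r₁ - s₀)) * (8 * k ^ 4 * x ^ (s₀ + τ' + δ * r₁))) := by gcongr
      _ = 96 * k ^ 7 * (x ^ (α * τ + (1 + ξ) * (s₀ + s₀)) * ρ ^ (-(r₁ - s₀)) *
          x ^ (s₀ + τ' + δ * r₁)) := by ring
      _ = _ := by
          rw [hρ, ← Real.rpow_mul hx0.le, mul_neg, ← Real.rpow_add hx0, ← Real.rpow_add hx0]
  have hατ : 0 < α * τ := mul_pos hα0 (by linarith)
  have hy1 : ∀ s, s₀ ≤ s → 1 ≤ x ^ (α * τ + (1 + ξ) * (s + s₀)) := fun s hs => by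
    have := mul_nonneg (by linarith : 0 ≤ 1 + ξ) (by linarith : 0 ≤ s + s₀)
    exact Real.one_le_rpow hx1 (by linarith)
  have key := sobNorm_inverse_le (s := s) (σ := x ^ (s₀ + τ' + δ * s))
    (σ₀ := x ^ (s₀ + τ' + δ * s₀)) (y := x ^ (α * τ + (1 + ξ) * (s + s₀)))
    (y₀ := x ^ (α * τ + (1 + ξ) * (s₀ + s₀))) (d₀ := sobNorm s₀ D)
    h hs1 (hkappa s hs2) hk1 (hσ1 s hs1) (hσ1 s₀ le_rfl)
    (hy1 s hs1) (hy1 s₀ le_rfl)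
    (sobNorm_nonneg s₀ D) (S := S) (P := P) B c hGA (by rw [hP]; abel)
    (by
      ext y z
      rw [siteProj_mul_apply]
      split_ifs with hy
      · exact hPrb y z hy
      · rfl)
    (hAnorm s hs2)
    ((hSn s hs1 hs2).trans (by gcongr; linarith))
    ((hSn s₀ le_rfl hsr₁).trans (by gcongr; linarith))
    (hPn s hs1 hs2) hP₀
    ((hcut _ 1 zero_le_one hGentry s hs1 hs2).trans (mul_one _).le)
    ((hcut _ 1 zero_le_one hGentry s₀ le_rfl hsr₁).trans (mul_one _).le)
    (by rw [hD])
    (by rw [← hD]; exact hcut _ _ (sobNorm_nonneg _ _) hGDentry s hs1 hs2)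
    (by rw [← hD]; exact hcut _ _ (sobNorm_nonneg _ _) hGDentry s₀ le_rfl hsr₁) hsmall
  refine (mul_le_mul_of_nonneg_left key hsC.le).trans ?_
  exact coupling_exponents hα hτ hξ hτ' hδ hδ1 hs₀ hs1 hs2 hξα hx1 hLge (by linarith) hk0 hsC.le L3

end MultiScale

/-! ### Goodness is a closed condition on the potential. -/

section Topology

variable {d : ℕ}

theorem continuous_sobNorm {X : Set (ZLat d)} [Fintype X] {s s₀ : ℝ} (h : (d : ℝ) / 2 < s₀)
    (hs : 0 ≤ s) : Continuous fun A : Matrix X X ℂ => sobNorm s A := by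
  obtain ⟨ρ, hρ⟩ := (Set.finite_range fun z : X × X =>
    ‖(z.1 : ZLat d) - (z.2 : ZLat d)‖).bddAbove
  set c := (max 1 ρ) ^ (s + s₀) * ‖bracketSeq h‖ with hc
  have hbound : ∀ A : Matrix X X ℂ, sobNorm s A ≤ (∑ x, ∑ y, ‖A x y‖) * c := fun A => by
    have := sobNorm_le_of_near_of_le (c := ∑ x, ∑ y, ‖A x y‖) h hs (le_max_left 1 ρ)
      (Finset.sum_nonneg fun _ _ => Finset.sum_nonneg fun _ _ => norm_nonneg _) A
      (fun x y _ => (hρ ⟨(x, y), rfl⟩).trans (le_max_right 1 ρ)) fun x y =>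
        (Finset.single_le_sum (f := fun y => ‖A x y‖) (fun _ _ => norm_nonneg _)
          (Finset.mem_univ y)).trans
        (Finset.single_le_sum (f := fun x => ∑ y, ‖A x y‖)
          (fun _ _ => Finset.sum_nonneg fun _ _ => norm_nonneg _) (Finset.mem_univ x))
    rwa [mul_assoc] at this
  refine continuous_iff_continuousAt.mpr fun A => ?_
  refine tendsto_iff_norm_sub_tendsto_zero.mpr (squeeze_zero (fun _ => norm_nonneg _)
    (g := fun B : Matrix X X ℂ => (∑ x, ∑ y, ‖(B - A) x y‖) * c) (fun B => ?_) ?_)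
  · refine le_trans ?_ (hbound (B - A))
    rw [Real.norm_eq_abs, abs_sub_le_iff]
    have h1 := sobNorm_add_le s (B - A) A
    have h2 := sobNorm_sub_le s B (B - A)
    rw [sub_add_cancel] at h1
    rw [sub_sub_cancel] at h2
    constructor <;> linarith
  · have hcont : Continuous fun B : Matrix X X ℂ => (∑ x, ∑ y, ‖(B - A) x y‖) * c := by
      refine Continuous.mul (continuous_finsetSum _ fun x _ => continuous_finsetSum _ fun y _ =>
        Continuous.norm ?_) continuous_const
      exact (continuous_id.sub continuous_const).matrix_elem x y
    have := hcont.tendsto A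
    simpa using this

/-- The set of potentials for which a given cube is good is closed. -/
theorem isClosed_isGood {s₀ C₀ : ℝ} (h : (d : ℝ) / 2 < s₀) (hC : 0 < C₀) {r₁ : ℝ}
    (hs : s₀ ≤ r₁) (τ' r lam E δ : ℝ) (l : ℕ) (n : ZLat d) :
    IsClosed {v : ZLat d → ℝ | IsGood C₀ s₀ r₁ τ' (hamiltonian d r lam v) E δ l n} := by
  have hs₀ : 0 ≤ s₀ := by have : (0:ℝ) ≤ d := Nat.cast_nonneg d; linarith
  have hsC : 0 < √C₀ := Real.sqrt_pos.mpr hC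
  -- Goodness says that H − E has a right inverse in this compact set. Projecting the closed set of
  -- pairs (potential, inverse) along a compact factor keeps it closed.
  let Bd : Set (Matrix (cube l n) (cube l n) ℂ) :=
    {N | ∀ s ∈ Icc s₀ r₁, matSobolevNorm C₀ s N ≤ (l : ℝ) ^ (τ' + δ * s)}
  have hBclosed : IsClosed Bd := by
    have : Bd = ⋂ s ∈ Icc s₀ r₁, {N | √C₀ * sobNorm s N ≤ (l : ℝ) ^ (τ' + δ * s)} := by
      ext N
      simp only [Bd, mem_ofPred_eq, mem_iInter, matSobolevNorm_eq hC.le]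
    rw [this]
    refine isClosed_biInter fun s hs' => isClosed_le ?_ continuous_const
    exact continuous_const.mul (continuous_sobNorm h (hs₀.trans hs'.1))
  have hBcomp : IsCompact Bd := by
    refine IsCompact.of_isClosed_subset (isCompact_univ_pi fun _ => isCompact_univ_pi fun _ =>
      isCompact_closedBall (0 : ℂ) ((√C₀)⁻¹ * (l : ℝ) ^ (τ' + δ * s₀))) hBclosed ?_
    intro N hN
    refine Set.mem_univ_pi.mpr fun x => Set.mem_univ_pi.mpr fun y => ?_
    rw [mem_closedBall_zero_iff]
    have h1 := hN s₀ ⟨le_rfl, hs⟩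
    rw [matSobolevNorm_eq hC.le] at h1
    rw [inv_mul_eq_div, le_div_iff₀ hsC, mul_comm]
    refine le_trans ?_ h1
    gcongr
    refine le_trans ?_ (le_sobNorm s₀ N x y)
    exact le_mul_of_one_le_right (norm_nonneg _) (Real.one_le_rpow (one_le_bracket _) hs₀)
  have : CompactSpace Bd := isCompact_iff_compactSpace.mp hBcomp
  let A : (ZLat d → ℝ) → Matrix (cube l n) (cube l n) ℂ := fun v =>
    restrict (hamiltonian d r lam v) (cube l n) - (E : ℂ) • 1
  have hA : Continuous A := by
    refine Continuous.sub (continuous_matrix fun x y => ?_) continuous_const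
    by_cases hxy : (x : ZLat d) = y
    · simp only [restrict, hamiltonian, Matrix.submatrix_apply, Matrix.add_apply,
        Matrix.smul_apply, hxy, Matrix.diagonal_apply_eq]
      exact continuous_const.add (Complex.continuous_ofReal.comp (continuous_apply _))
    · simp only [restrict, hamiltonian, Matrix.submatrix_apply, Matrix.add_apply,
        Matrix.smul_apply, Matrix.diagonal_apply_ne _ hxy]
      exact continuous_const
  have hcl : IsClosed {q : (ZLat d → ℝ) × Bd | A q.1 * (q.2 : Matrix _ _ ℂ) = 1} :=
    isClosed_eq ((hA.comp continuous_fst).matrix_mul (continuous_subtype_val.comp continuous_snd))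
      continuous_const
  have hproj := isClosedMap_fst_of_compactSpace _ hcl
  convert hproj using 1
  ext v
  simp only [mem_ofPred_eq, mem_image, Prod.exists, exists_and_right, exists_eq_right]
  constructor
  · rintro ⟨hu, hN⟩
    exact ⟨⟨green (hamiltonian d r lam v) l n E, hN⟩,
      Matrix.mul_nonsing_inv _ ((Matrix.isUnit_iff_isUnit_det _).mp hu)⟩
  · rintro ⟨N, hN⟩
    have h1 : green (hamiltonian d r lam v) l n E = N := Matrix.inv_eq_right_inv hN
    refine ⟨IsUnit.of_mul_eq_one _ hN, fun s hs' => ?_⟩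
    rw [h1]
    exact N.2 s hs'

theorem isGood_congr {C₀ s₀ r₁ τ' r lam E δ : ℝ} {l : ℕ} {n : ZLat d} {v w : ZLat d → ℝ}
    (hvw : ∀ k ∈ cube l n, v k = w k) :
    IsGood C₀ s₀ r₁ τ' (hamiltonian d r lam v) E δ l n ↔
      IsGood C₀ s₀ r₁ τ' (hamiltonian d r lam w) E δ l n := by
  have h1 : restrict (hamiltonian d r lam v) (cube l n) =
      restrict (hamiltonian d r lam w) (cube l n) := by
    ext x y
    by_cases hxy : (x : ZLat d) = y
    · simp [restrict, hamiltonian, hxy, hvw _ y.2]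
    · simp [restrict, hamiltonian, hxy]
  unfold IsGood green
  rw [h1]

end Topology

/-! ### Independence and counting of bad cubes. -/

section Probability

variable {d : ℕ}

/-- All cubes with centres in `K` are bad, for some common energy. -/
def AllBad (C₀ s₀ r₁ τ' r lam δ : ℝ) (I : Set ℝ) (l : ℕ) (K : Finset (ZLat d))
    (v : ZLat d → ℝ) : Prop :=
  ∃ E ∈ I, ∀ k ∈ K, ¬ IsGood C₀ s₀ r₁ τ' (hamiltonian d r lam v) E δ l k

/-- Openness survives the uncountable union over energies; this is what makes the event measurable.
-/
theorem isOpen_allBad {s₀ C₀ : ℝ} (h : (d : ℝ) / 2 < s₀) (hC : 0 < C₀) {r₁ : ℝ}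
    (hs : s₀ ≤ r₁) (τ' r lam δ : ℝ) (I : Set ℝ) (l : ℕ) (K : Finset (ZLat d)) :
    IsOpen {v : ZLat d → ℝ | AllBad C₀ s₀ r₁ τ' r lam δ I l K v} := by
  have : {v : ZLat d → ℝ | AllBad C₀ s₀ r₁ τ' r lam δ I l K v} =
      ⋃ E ∈ I, ⋂ k ∈ K, {v | IsGood C₀ s₀ r₁ τ' (hamiltonian d r lam v) E δ l k}ᶜ := by
    ext v
    simp [AllBad]
  rw [this]
  exact isOpen_biUnion fun E _ => isOpen_biInter_finset fun k _ =>
    (isClosed_isGood h hC hs τ' r lam E δ l k).isOpen_compl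

/-- The sites on which the cubes with centres in `K` depend. -/
def cubeSites (l : ℕ) (K : Finset (ZLat d)) : Set (ZLat d) := ⋃ k ∈ K, cube l k

/-- Setting the potential to 0 outside the cubes does not affect goodness, and the truncated
potential is measurable for the sites involved. Independence needs exactly this σ-algebra. -/
theorem measurableSet_allBad {Ω : Type*} {s₀ C₀ : ℝ} (h : (d : ℝ) / 2 < s₀) (hC : 0 < C₀) {r₁ : ℝ}
    (hs : s₀ ≤ r₁) (τ' r lam δ : ℝ) (I : Set ℝ) (l : ℕ) (K : Finset (ZLat d))
    (V : ZLat d → Ω → ℝ) :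
    MeasurableSet[⨆ k ∈ cubeSites l K, MeasurableSpace.comap (V k) inferInstance]
      {ω | AllBad C₀ s₀ r₁ τ' r lam δ I l K fun k => V k ω} := by
  classical
  let Φ : Ω → ZLat d → ℝ := fun ω k => if k ∈ cubeSites l K then V k ω else 0
  have hΦ : Measurable[⨆ k ∈ cubeSites l K, MeasurableSpace.comap (V k) inferInstance] Φ := by
    refine @measurable_pi_lambda _ _ _ (_) _ _ fun k => ?_
    by_cases hk : k ∈ cubeSites l K
    · simp only [Φ, hk, if_true]
      exact (comap_measurable (V k)).mono
        (le_iSup₂ (f := fun k (_ : k ∈ cubeSites l K) =>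
          MeasurableSpace.comap (V k) (inferInstance : MeasurableSpace ℝ)) k hk) le_rfl
    · simp only [Φ, hk, if_false]
      exact @measurable_const _ _ _ (_) _
  have h1 := hΦ (isOpen_allBad h hC hs τ' r lam δ I l K).measurableSet
  convert h1 using 1
  ext ω
  simp only [mem_ofPred_eq, mem_preimage, AllBad]
  refine exists_congr fun E => and_congr_right fun _ => forall₂_congr fun k hk => not_congr ?_
  refine isGood_congr fun j hj => ?_
  have : j ∈ cubeSites l K := mem_biUnion (Finset.mem_coe.mpr hk) hj
  simp [Φ, this]

theorem disjoint_cubeSites {l : ℕ} {K K' : Finset (ZLat d)}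
    (h : ∀ k ∈ K, ∀ k' ∈ K', 2 * (l : ℝ) < ‖k - k'‖) :
    Disjoint (cubeSites l K) (cubeSites l K') := by
  rw [Set.disjoint_left]
  intro j hj hj'
  obtain ⟨k, hk, hjk⟩ := mem_iUnion₂.mp hj
  obtain ⟨k', hk', hjk'⟩ := mem_iUnion₂.mp hj'
  have h1 := h k hk k' hk'
  have h2 : k - k' = (j - k') - (j - k) := by abel
  rw [h2] at h1
  have h3 := norm_sub_le (j - k') (j - k)
  have h4 : ‖j - k‖ ≤ l := hjk
  have h5 : ‖j - k'‖ ≤ l := hjk'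
  linarith

variable {Ω : Type*} [MeasurableSpace Ω]

/-- The probability that an even number of separated cubes are bad for a common energy. -/
theorem measureReal_allBad_le {s₀ C₀ : ℝ} (h : (d : ℝ) / 2 < s₀) (hC : 0 < C₀) {r₁ : ℝ}
    (hs : s₀ ≤ r₁) {τ' r lam δ : ℝ} {I : Set ℝ} {l : ℕ} {P : Measure Ω} [IsProbabilityMeasure P]
    {V : ZLat d → Ω → ℝ} (hV : ∀ n, Measurable (V n)) (hind : iIndepFun V P) {q : ℝ}
    (hq : ∀ m n : ZLat d, 2 * (l : ℝ) < ‖m - n‖ →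
      P.real {ω | BothBad C₀ s₀ r₁ τ' (hamiltonian d r lam fun k => V k ω) I δ l m n} ≤ q)
    (j : ℕ) (K : Finset (ZLat d)) (hK : K.card = j + j)
    (hsep : (K : Set (ZLat d)).Pairwise fun a b => 2 * (l : ℝ) < ‖a - b‖) :
    P.real {ω | AllBad C₀ s₀ r₁ τ' r lam δ I l K fun k => V k ω} ≤ q ^ j := by
  classical
  induction j generalizing K with
  | zero => rw [pow_zero]; exact measureReal_le_one
  | succ j ih =>
    -- One pair is split off. Separation makes its cubes disjoint from the others, hence independent
    -- of them, and a common bad energy for all cubes serves both groups.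
    obtain ⟨a, ha⟩ : K.Nonempty := Finset.card_pos.mp (by omega)
    obtain ⟨b, hb⟩ : (K.erase a).Nonempty := by
      rw [← Finset.card_pos, Finset.card_erase_of_mem ha]; omega
    have hbK := Finset.mem_of_mem_erase hb
    have hba := Finset.ne_of_mem_erase hb
    set K' := (K.erase a).erase b with hK'
    have hK'K : K' ⊆ K := (Finset.erase_subset _ _).trans (Finset.erase_subset _ _)
    have hcard : K'.card = j + j := by
      rw [hK', Finset.card_erase_of_mem hb, Finset.card_erase_of_mem ha]; omega
    have hKa : ∀ k ∈ K', k ≠ a ∧ k ≠ b := fun k hk =>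
      ⟨Finset.ne_of_mem_erase (Finset.mem_of_mem_erase hk), Finset.ne_of_mem_erase hk⟩
    have hdisj : Disjoint (cubeSites l K') (cubeSites l {a, b}) := by
      refine disjoint_cubeSites fun k hk k' hk' => ?_
      rcases Finset.mem_insert.mp hk' with rfl | hk'
      · exact hsep (hK'K hk) ha (hKa k hk).1
      · rw [Finset.mem_singleton] at hk'
        subst hk'
        exact hsep (hK'K hk) hbK (hKa k hk).2
    have hindep := indep_iSup_of_disjoint (fun k => (hV k).comap_le)
      ((iIndepFun_iff_iIndep _ _ _).mp hind) hdisj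
    have hprod := (Indep_iff _ _ _).mp hindep _ _
      (measurableSet_allBad h hC hs τ' r lam δ I l K' V)
      (measurableSet_allBad h hC hs τ' r lam δ I l {a, b} V)
    have hpair : {ω | AllBad C₀ s₀ r₁ τ' r lam δ I l {a, b} fun k => V k ω} =
        {ω | BothBad C₀ s₀ r₁ τ' (hamiltonian d r lam fun k => V k ω) I δ l a b} := by
      ext ω
      simp [AllBad, BothBad]
    have hq1 := hq a b (hsep ha hbK hba.symm)
    have hq0 : 0 ≤ q := measureReal_nonneg.trans hq1
    have hsub : {ω | AllBad C₀ s₀ r₁ τ' r lam δ I l K fun k => V k ω} ⊆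
        {ω | AllBad C₀ s₀ r₁ τ' r lam δ I l K' fun k => V k ω} ∩
        {ω | AllBad C₀ s₀ r₁ τ' r lam δ I l {a, b} fun k => V k ω} := by
      rintro ω ⟨E, hE, hbad⟩
      refine ⟨⟨E, hE, fun k hk => hbad k (hK'K hk)⟩, ⟨E, hE, fun k hk => hbad k ?_⟩⟩
      rcases Finset.mem_insert.mp hk with rfl | hk
      · exact ha
      · rw [Finset.mem_singleton] at hk
        exact hk ▸ hbK
    calc _ ≤ P.real ({ω | AllBad C₀ s₀ r₁ τ' r lam δ I l K' fun k => V k ω} ∩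
          {ω | AllBad C₀ s₀ r₁ τ' r lam δ I l {a, b} fun k => V k ω}) := measureReal_mono hsub
      _ = P.real {ω | AllBad C₀ s₀ r₁ τ' r lam δ I l K' fun k => V k ω} *
          P.real {ω | AllBad C₀ s₀ r₁ τ' r lam δ I l {a, b} fun k => V k ω} := by
          rw [measureReal_def, hprod, ENNReal.toReal_mul]; rfl
      _ ≤ q ^ j * q := by
          rw [hpair]
          exact mul_le_mul (ih K' hcard (hsep.mono (Finset.coe_subset.mpr hK'K))) hq1
            measureReal_nonneg (pow_nonneg hq0 j)
      _ = _ := (pow_succ q j).symm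

theorem card_cube_le {L : ℕ} (hL : 1 ≤ L) (n : ZLat d) :
    ((cube_finite L n).toFinset.card : ℝ) ≤ (3 ^ d) * (L : ℝ) ^ d := by
  have h1 : (cube_finite L n).toFinset ⊆
      Finset.Icc (fun i => n i - (L : ℤ)) (fun i => n i + (L : ℤ)) := by
    intro k hk
    rw [Set.Finite.mem_toFinset, mem_cube_iff] at hk
    rw [Finset.mem_Icc]
    constructor <;> intro i <;> have := abs_le.mp (hk i) <;> dsimp only <;> omega
  have h2 := Finset.card_le_card h1
  have h3 : (Finset.Icc (fun i => n i - (L : ℤ)) (fun i => n i + (L : ℤ))).card =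
      (2 * L + 1) ^ d := by
    rw [Pi.card_Icc]
    simp only [Int.card_Icc]
    have : ∀ i, (n i + (L : ℤ) + 1 - (n i - L)).toNat = 2 * L + 1 := fun i => by omega
    simp [this]
  rw [h3] at h2
  calc ((cube_finite L n).toFinset.card : ℝ) ≤ (((2 * L + 1) ^ d : ℕ) : ℝ) := by exact_mod_cast h2
    _ ≤ (3 * (L : ℝ)) ^ d := by
      push_cast
      have : (1 : ℝ) ≤ L := by exact_mod_cast hL
      gcongr
      linarith
    _ = _ := mul_pow _ _ _

/-- The probability that a large cube contains an even number of separated bad centres for a common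
energy. -/
theorem measureReal_exists_allBad_le {s₀ C₀ : ℝ} (h : (d : ℝ) / 2 < s₀) (hC : 0 < C₀) {r₁ : ℝ}
    (hs : s₀ ≤ r₁) {τ' r lam δ : ℝ} {I : Set ℝ} {l L : ℕ} (hL : 1 ≤ L)
    {P : Measure Ω} [IsProbabilityMeasure P]
    {V : ZLat d → Ω → ℝ} (hV : ∀ n, Measurable (V n)) (hind : iIndepFun V P) {q : ℝ} (hq0 : 0 ≤ q)
    (hq : ∀ m n : ZLat d, 2 * (l : ℝ) < ‖m - n‖ →
      P.real {ω | BothBad C₀ s₀ r₁ τ' (hamiltonian d r lam fun k => V k ω) I δ l m n} ≤ q)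
    (j : ℕ) (n : ZLat d) :
    P.real {ω | ∃ K : Finset (ZLat d), (K : Set (ZLat d)) ⊆ cube L n ∧ K.card = j + j ∧
        (K : Set (ZLat d)).Pairwise (fun a b => 2 * (l : ℝ) < ‖a - b‖) ∧
        AllBad C₀ s₀ r₁ τ' r lam δ I l K fun k => V k ω} ≤
      Real.exp (3 ^ d) * ((L : ℝ) ^ d) ^ (j + j) * q ^ j := by
  classical
  set F : Finset (Finset (ZLat d)) := ((cube_finite L n).toFinset.powersetCard (j + j)).filter
    fun K : Finset (ZLat d) => (K : Set (ZLat d)).Pairwise fun a b => 2 * (l : ℝ) < ‖a - b‖ with hF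
  have hsub : {ω | ∃ K : Finset (ZLat d), (K : Set (ZLat d)) ⊆ cube L n ∧ K.card = j + j ∧
        (K : Set (ZLat d)).Pairwise (fun a b => 2 * (l : ℝ) < ‖a - b‖) ∧
        AllBad C₀ s₀ r₁ τ' r lam δ I l K fun k => V k ω} ⊆
      ⋃ K ∈ F, {ω | AllBad C₀ s₀ r₁ τ' r lam δ I l K fun k => V k ω} := by
    rintro ω ⟨K, hKL, hcard, hsep, hbad⟩
    refine mem_biUnion (x := K) ?_ hbad
    rw [hF, Finset.mem_coe, Finset.mem_filter, Finset.mem_powersetCard]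
    exact ⟨⟨fun k hk => (Set.Finite.mem_toFinset _).mpr (hKL hk), hcard⟩, hsep⟩
  -- The factorial in the binomial bound is kept: x^n/n! ≤ e^x makes the constant independent of the
  -- number of cubes.
  have hFcard : (F.card : ℝ) ≤ Real.exp (3 ^ d) * ((L : ℝ) ^ d) ^ (j + j) := by
    calc (F.card : ℝ) ≤ (((cube_finite L n).toFinset.powersetCard (j + j)).card : ℝ) := by
          exact_mod_cast Finset.card_filter_le _ _
      _ ≤ ((cube_finite L n).toFinset.card : ℝ) ^ (j + j) / (j + j).factorial := by
          rw [Finset.card_powersetCard]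
          exact Nat.choose_le_pow_div _ _
      _ ≤ (3 ^ d * (L : ℝ) ^ d) ^ (j + j) / (j + j).factorial := by
          gcongr
          exact card_cube_le hL n
      _ = ((3 ^ d : ℝ) ^ (j + j) / (j + j).factorial) * ((L : ℝ) ^ d) ^ (j + j) := by
          rw [mul_pow]; ring
      _ ≤ _ := by
          gcongr
          exact Real.pow_div_factorial_le_exp _ (by positivity) _
  calc _ ≤ P.real (⋃ K ∈ F, {ω | AllBad C₀ s₀ r₁ τ' r lam δ I l K fun k => V k ω}) :=
        measureReal_mono hsub (measure_ne_top _ _)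
    _ ≤ ∑ K ∈ F, P.real {ω | AllBad C₀ s₀ r₁ τ' r lam δ I l K fun k => V k ω} :=
        measureReal_biUnion_finset_le _ _
    _ ≤ ∑ _K ∈ F, q ^ j := by
        refine Finset.sum_le_sum fun K hK => ?_
        rw [hF, Finset.mem_filter, Finset.mem_powersetCard] at hK
        exact measureReal_allBad_le h hC hs hV hind hq j K hK.1.2 hK.2
    _ = F.card * q ^ j := by rw [Finset.sum_const, nsmul_eq_mul]
    _ ≤ _ := by gcongr

end Probability

/-! ### Passage from the events to the theorem. -/

section Main

variable {d : ℕ}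

theorem abs_sub_le_one_of_mem {I : Set ℝ} (hI : I.OrdConnected) (hvol : volume I ≤ 1) {E E₀ : ℝ}
    (hE : E ∈ I) (hE₀ : E₀ ∈ I) : |E - E₀| ≤ 1 := by
  have h1 : volume (uIcc E₀ E) ≤ 1 := (measure_mono (hI.uIcc_subset hE₀ hE)).trans hvol
  rw [Real.volume_interval] at h1
  exact ENNReal.ofReal_le_one.mp h1

/-- If E were within η of a point of each set, those points would be within 2η of each other. This
makes (P2) effective for all energies at once. -/
theorem le_dist_of_setDist_gt {S T : Set ℂ} {η E : ℝ} (h : 2 * η < setDist S T) :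
    (∀ a ∈ S, η ≤ ‖a - E‖) ∨ ∀ b ∈ T, η ≤ ‖b - E‖ := by
  by_contra! hcon
  obtain ⟨⟨a, ha, haE⟩, b, hb, hbE⟩ := hcon
  have h1 : setDist S T ≤ dist a b :=
    csInf_le ⟨0, by rintro _ ⟨a, -, b, -, rfl⟩; exact dist_nonneg⟩ (mem_image2_of_mem ha hb)
  rw [dist_eq_norm] at h1
  have h2 : a - b = (a - E) - (b - E) := by ring
  rw [h2] at h1
  have h3 := norm_sub_le (a - (E : ℂ)) (b - E)
  linarith

theorem ae_abs_le_of_support {Ω : Type*} [MeasurableSpace Ω] {P : Measure Ω} {μ : Measure ℝ}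
    {V : ZLat d → Ω → ℝ} (hV : ∀ n, Measurable (V n)) (hμ : ∀ n, P.map (V n) = μ) {M : ℝ}
    (hsupp : μ.support ⊆ Icc (-M) M) : ∀ᵐ ω ∂P, ∀ n, |V n ω| ≤ M := by
  rw [ae_all_iff]
  intro n
  have h1 : ∀ᵐ x ∂μ, x ∈ μ.support := Measure.measure_compl_support
  rw [← hμ n] at h1
  filter_upwards [ae_of_ae_map (hV n).aemeasurable h1] with ω hω
  rw [hμ n] at hω
  exact abs_le.mpr (hsupp hω)

/-- Since l ≥ L^{1/α}, each of the j pairs gains L^{-2p/α}, against L^{2dj} choices of centres. -/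
theorem rpow_count_le {l L α p : ℝ} (d j : ℕ) (hL : 1 ≤ L) (hα : 0 < α) (hp : 0 < p)
    (hl : 0 ≤ l) (hlL : L ≤ l ^ α) :
    (L ^ d) ^ (j + j) * (l ^ (-(2 * p))) ^ j ≤
      L ^ (-((j + j : ℕ) : ℝ) * (α⁻¹ * p - d)) := by
  have hL0 : 0 < L := by linarith
  have h1 : L ^ α⁻¹ ≤ l := by
    calc L ^ α⁻¹ ≤ (l ^ α) ^ α⁻¹ := by gcongr
      _ = l := Real.rpow_rpow_inv hl hα.ne'
  have h2 : l ^ (-(2 * p)) ≤ (L ^ α⁻¹) ^ (-(2 * p)) :=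
    Real.rpow_le_rpow_of_nonpos (Real.rpow_pos_of_pos hL0 _) h1 (by linarith)
  calc (L ^ d) ^ (j + j) * (l ^ (-(2 * p))) ^ j ≤
        (L ^ d) ^ (j + j) * ((L ^ α⁻¹) ^ (-(2 * p))) ^ j := by
        have := Real.rpow_nonneg hl (-(2 * p))
        gcongr
    _ = _ := by
        rw [← Real.rpow_mul hL0.le, ← Real.rpow_natCast (L ^ _) j, ← Real.rpow_mul hL0.le,
          ← pow_mul, ← Real.rpow_natCast L, ← Real.rpow_add hL0]
        congr 1
        push_cast
        ring

end Main

end LongRange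

theorem mainTheorem2 (d : ℕ) (hd : 1 ≤ d) :
    -- the constant `C(d)`
    ∃ C : ℝ, 0 < C ∧
    ∀ (s₀ C₀ : ℝ), (d : ℝ) / 2 < s₀ → LongRange.IsSobolevConst d s₀ C₀ →
    -- `t` is the value of the Sobolev norm `‖T‖_{r₁}`
    ∀ (t M α τ ξ τ' δ p r₁ : ℝ) (J : ℕ),
      0 < M → 1 < α → 1 < τ → 0 < ξ → 1 < τ' → 0 < δ → δ < 1 → 1 < r₁ → s₀ ≤ r₁ →
      -(1 - δ) * r₁ + τ' + 2 * s₀ < 0 →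
      -ξ * r₁ + τ' + α * τ + (3 + δ + 4 * ξ) * s₀ < 0 →
      α⁻¹ * (2 * τ' + 2 * α * τ + (5 + 4 * ξ + 2 * δ) * s₀) + s₀ < τ' →
      1 + ξ < α → α * d < p → Even J →
    ∃ l₀ : ℝ, 0 < l₀ ∧
    ∀ r : ℝ, (d : ℝ) < r → r₁ < r - (d : ℝ) / 2 →
      LongRange.matSobolevNorm C₀ r₁ (LongRange.restrict (LongRange.hopping d r) Set.univ) = t →
    -- the coupling constant and the i.i.d. potential with common law `μ`
    ∀ (lam : ℝ), 1 ≤ lam →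
    ∀ (μ : Measure ℝ), μ.support.Nontrivial → μ.support ⊆ Set.Icc (-M) M →
    ∀ (Ω : Type*) [MeasurableSpace Ω] (P : Measure Ω) [IsProbabilityMeasure P]
      (V : LongRange.ZLat d → Ω → ℝ),
      (∀ n, Measurable (V n)) → (∀ n, P.map (V n) = μ) → iIndepFun V P →
    -- the energy interval
    ∀ I : Set ℝ, I.OrdConnected → volume I ≤ 1 →
      (I ∩ Set.Icc (-‖LongRange.hoppingOp d r‖ - M) (‖LongRange.hoppingOp d r‖ + M)).Nonempty →
    ∀ l L : ℕ, L = ⌊(l : ℝ) ^ α⌋₊ → l₀ ≤ (l : ℝ) →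
    -- (P1)
    (∀ m n : LongRange.ZLat d, 2 * (l : ℝ) < ‖m - n‖ →
      P.real {ω | LongRange.BothBad C₀ s₀ r₁ τ'
          (LongRange.hamiltonian d r lam fun k => V k ω) I δ l m n}
        ≤ (l : ℝ) ^ (-(2 * p))) →
    -- (P2)
    (∀ m n : LongRange.ZLat d, 2 * (L : ℝ) < ‖m - n‖ →
      P.real {ω | LongRange.setDist
          (spectrum ℂ (LongRange.restrict (LongRange.hamiltonian d r lam fun k => V k ω)
            (LongRange.cube L m)))
          (spectrum ℂ (LongRange.restrict (LongRange.hamiltonian d r lam fun k => V k ω)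
            (LongRange.cube L n))) ≤ 2 * (L : ℝ) ^ (-τ)}
        ≤ (L : ℝ) ^ (-(2 * p)) / 2) →
    ∀ m n : LongRange.ZLat d, 2 * (L : ℝ) < ‖m - n‖ →
      P.real {ω | LongRange.BothBad C₀ s₀ r₁ τ'
          (LongRange.hamiltonian d r lam fun k => V k ω) I ((1 + ξ) / α) L m n}
        ≤ C * (L : ℝ) ^ (-(J : ℝ) * (α⁻¹ * p - d)) + (L : ℝ) ^ (-(2 * p)) / 2 := by
  -- The factor 2 accounts for the two cubes, each contributing exp(3^d).
  refine ⟨2 * Real.exp (3 ^ d), by positivity, ?_⟩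
  intro s₀ C₀ h hC t M α τ ξ τ' δ p r₁ J hM hα hτ hξ hτ' hδ hδ1 _ hsr hc1 hc2 hc3 hξα hp hJ
  obtain ⟨l₀, hl₀, hgood⟩ := LongRange.exists_isGood_of_few_bad (t := t) (M := M) (J := J) h hC.1
    hM hα hτ hξ hτ' hδ hδ1 hsr hc1 hc2 hc3 hξα
  refine ⟨l₀, by linarith, ?_⟩
  intro r _ hr₁ ht lam hlam μ _ hsupp Ω _ P _ V hV hμ hind I hI hvol hIne l L hL hl hP1 hP2 m n hmn
  have hα0 : 0 < α := by linarith
  have hp0 : 0 < p := lt_of_le_of_lt (by positivity) hp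
  have hl1 : (1 : ℝ) ≤ l := by linarith
  have hlα : 1 ≤ (l : ℝ) ^ α := Real.one_le_rpow hl1 hα0.le
  have hL1 : 1 ≤ L := by rw [hL]; exact Nat.le_floor (by exact_mod_cast hlα)
  have hLα : (L : ℝ) ≤ (l : ℝ) ^ α := by rw [hL]; exact Nat.floor_le (by linarith)
  obtain ⟨j, rfl⟩ := hJ
  obtain ⟨E₀, hE₀I, hE₀⟩ := hIne
  have hEbound : ∀ E ∈ I, |E| ≤ ‖LongRange.hoppingOp d r‖ + M + 1 := fun E hE => by
    have h1 := abs_le.mp (LongRange.abs_sub_le_one_of_mem hI hvol hE hE₀I)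
    have h2 := hE₀.1
    have h3 := hE₀.2
    rw [abs_le]
    constructor <;> linarith [h1.1, h1.2]
  let many : LongRange.ZLat d → Set Ω := fun z =>
    {ω | ∃ K : Finset (LongRange.ZLat d), (K : Set (LongRange.ZLat d)) ⊆ LongRange.cube L z ∧
      K.card = j + j ∧ (K : Set (LongRange.ZLat d)).Pairwise (fun a b => 2 * (l : ℝ) < ‖a - b‖) ∧
      LongRange.AllBad C₀ s₀ r₁ τ' r lam δ I l K fun k => V k ω}
  let close : Set Ω := {ω | LongRange.setDist
      (spectrum ℂ (LongRange.restrict (LongRange.hamiltonian d r lam fun k => V k ω)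
        (LongRange.cube L m)))
      (spectrum ℂ (LongRange.restrict (LongRange.hamiltonian d r lam fun k => V k ω)
        (LongRange.cube L n))) ≤ 2 * (L : ℝ) ^ (-τ)}
  -- A null event: the potential is bounded by M only almost surely, while the deterministic step
  -- needs the bound at every site.
  let out : Set Ω := {ω | ¬ ∀ k, |V k ω| ≤ M}
  have hout : P.real out = 0 := by
    have h1 : P out = 0 := LongRange.ae_abs_le_of_support hV hμ hsupp
    rw [measureReal_def, h1, ENNReal.toReal_zero]
  have hmany : ∀ z, P.real (many z) ≤
      Real.exp (3 ^ d) * (L : ℝ) ^ (-((j + j : ℕ) : ℝ) * (α⁻¹ * p - d)) := fun z => by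
    refine (LongRange.measureReal_exists_allBad_le h hC.1 hsr hL1 hV hind (by positivity) hP1 j
      z).trans ?_
    rw [mul_assoc]
    gcongr
    exact LongRange.rpow_count_le d j (by exact_mod_cast hL1) hα0 hp0 (by linarith) hLα
  have hstep : ∀ ω, ω ∉ out → ∀ E ∈ I, ∀ z, ω ∉ many z →
      (∀ a ∈ spectrum ℂ (LongRange.restrict (LongRange.hamiltonian d r lam fun k => V k ω)
        (LongRange.cube L z)), (L : ℝ) ^ (-τ) ≤ ‖a - E‖) →
      LongRange.IsGood C₀ s₀ r₁ τ' (LongRange.hamiltonian d r lam fun k => V k ω) E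
        ((1 + ξ) / α) L z := by
    intro ω hω E hE z hz hspec
    refine hgood r hr₁ ht lam hlam _ (not_not.mp hω) E (hEbound E hE) l L hL hl z ?_ hspec
    intro K hKz hbad hsep
    by_contra! hcard
    -- A family of at least J centres is thinned to exactly J, the cardinality counted in `many`.
    obtain ⟨K', hK'K, hK'⟩ := Finset.exists_subset_card_eq hcard
    exact hz ⟨K', (Finset.coe_subset.mpr hK'K).trans hKz, hK',
      hsep.mono (Finset.coe_subset.mpr hK'K), E, hE, fun k hk => hbad k (hK'K hk)⟩
  have hsub : {ω | LongRange.BothBad C₀ s₀ r₁ τ'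
      (LongRange.hamiltonian d r lam fun k => V k ω) I ((1 + ξ) / α) L m n} ⊆
      (out ∪ (many m ∪ many n)) ∪ close := by
    rintro ω ⟨E, hE, hm, hn⟩
    by_contra hcon
    simp only [mem_union, not_or] at hcon
    obtain ⟨⟨ho, hmm, hmn'⟩, hcl⟩ := hcon
    rcases LongRange.le_dist_of_setDist_gt (E := E) (not_le.mp hcl) with hs | hs
    · exact hm (hstep ω ho E hE m hmm hs)
    · exact hn (hstep ω ho E hE n hmn' hs)
  have hclose : P.real close ≤ (L : ℝ) ^ (-(2 * p)) / 2 := hP2 m n hmn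
  have u1 := measureReal_mono (μ := P) hsub (measure_ne_top _ _)
  have u2 := measureReal_union_le (μ := P) (out ∪ (many m ∪ many n)) close
  have u3 := measureReal_union_le (μ := P) out (many m ∪ many n)
  have u4 := measureReal_union_le (μ := P) (many m) (many n)
  have hm := hmany m
  have hn := hmany n
  linarith
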